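/- Let $p>3$ be a prime and $\delta\ge 2$ an integer. Put $R=\mathbb{Z}/p^{\delta}$, $M=R[X,Y]$ and $G=SL_2(R)$, where $g=\begin{pmatrix}a&b\\c&d\end{pmatrix}\in G$ acts on $M$ by $(g\cdot P)(X,Y)=P(aX+cY,\,bX+dY)$. Let $I_G$ be the augmentation ideal of the group ring of $G$, let $M_G=M/I_GM$ be the module of coinvariants, and let $(M_G)_d$ be its degree $d$ part, i.e. the image in $M_G$ of the homogeneous polynomials of degree $d$. For a finite $R$-module $N$ let $\operatorname{rank}_R N$ denote the rank of the free part of $N$, i.e. the number of summands isomorphic to $R$ in a decomposition of $N$ as a direct sum of cyclic modules. Then $$\sum_{d\ge 0}\operatorname{rank}_{R}\,(M_G)_d\;t^d \;=\; 1+\frac{t^{\,p^{\delta+1}+p^{\delta-1}-2}}{\bigl(1-t^{\,p^{\delta-1}(p+1)}\bigr)\bigl(1-t^{\,p^{\delta}(p-1)}\bigr)}.$$ -/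

import Mathlib

noncomputable section

/-- The linear substitution of `R[X, Y]` given by a matrix: writing `X 0 = X` and `X 1 = Y`, the
matrix `(a b; c d)` sends `P(X, Y)` to `P(aX + cY, bX + dY)`. -/
def polySubst {R : Type} [CommRing R] (g : Matrix (Fin 2) (Fin 2) R) :
    MvPolynomial (Fin 2) R →ₐ[R] MvPolynomial (Fin 2) R :=
  MvPolynomial.aeval fun j : Fin 2 => ∑ i : Fin 2, g i j • (MvPolynomial.X i)

theorem polySubst_X {R : Type} [CommRing R] (g : Matrix (Fin 2) (Fin 2) R) (j : Fin 2) :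
    polySubst g (MvPolynomial.X j) =
      g 0 j • MvPolynomial.X 0 + g 1 j • MvPolynomial.X 1 := by
  rw [polySubst, MvPolynomial.aeval_X, Fin.sum_univ_two]

theorem polySubst_one {R : Type} [CommRing R] :
    polySubst (1 : Matrix (Fin 2) (Fin 2) R) = AlgHom.id R _ := by
  apply MvPolynomial.algHom_ext
  intro j
  rw [polySubst_X]
  fin_cases j <;> simp [Matrix.one_apply]

theorem polySubst_mul {R : Type} [CommRing R] (g h : Matrix (Fin 2) (Fin 2) R) :
    polySubst (g * h) = (polySubst g).comp (polySubst h) := by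
  apply MvPolynomial.algHom_ext
  intro j
  rw [AlgHom.comp_apply, polySubst_X, polySubst_X, map_add, map_smul, map_smul, polySubst_X,
    polySubst_X, Matrix.mul_apply, Matrix.mul_apply, Fin.sum_univ_two, Fin.sum_univ_two]
  module

/-- The natural action of `SL₂(R)` on `R[X, Y]` by linear substitutions. -/
def polyAction (R : Type) [CommRing R] :
    Representation R (Matrix.SpecialLinearGroup (Fin 2) R) (MvPolynomial (Fin 2) R) where
  toFun g := (polySubst (g : Matrix (Fin 2) (Fin 2) R)).toLinearMap
  map_one' := by
    rw [Matrix.SpecialLinearGroup.coe_one, polySubst_one]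
    rfl
  map_mul' g h := by
    rw [Matrix.SpecialLinearGroup.coe_mul, polySubst_mul]
    rfl

/-- `(M_G)_d` for `M = R[X, Y]` and `G = SL₂(R)`: the degree `d` part of the module of
coinvariants `M_G = M / I_G M`, that is, the image in `M_G` of the homogeneous polynomials of
degree `d`. -/
def coinvariantsDegree (R : Type) [CommRing R] (d : ℕ) :
    Submodule R (Representation.Coinvariants (polyAction R)) :=
  (MvPolynomial.homogeneousSubmodule (Fin 2) R d).map
    (Representation.Coinvariants.mk (polyAction R))

/-- For a finite `ℤ/p^δ`-module `N`, which by the elementary divisor theorem is the direct sum of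
a free module and of cyclic modules killed by `p^(δ-1)`, the rank of the free part is
`Module.finrank` (the largest number of linearly independent elements). -/
theorem finrank_eq_rank_free_part {p δ r : ℕ} (hp : p.Prime) (hδ : 1 ≤ δ)
    {N K : Type} [AddCommGroup N] [Module (ZMod (p ^ δ)) N] [Module.Finite (ZMod (p ^ δ)) N]
    [AddCommGroup K] [Module (ZMod (p ^ δ)) K]
    (e : N ≃ₗ[ZMod (p ^ δ)] (Fin r → ZMod (p ^ δ)) × K)
    (hK : ∀ k : K, (p : ZMod (p ^ δ)) ^ (δ - 1) • k = 0) :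
    Module.finrank (ZMod (p ^ δ)) N = r := by
  have : Fact (1 < p ^ δ) := ⟨Nat.one_lt_pow (by omega) hp.one_lt⟩
  have : NeZero (p ^ δ) := ⟨by have := this.out; omega⟩
  -- an element killed by `p` is a multiple of `p ^ (δ - 1)`
  have key : ∀ c : ZMod (p ^ δ), (p : ZMod (p ^ δ)) * c = 0 →
      ∃ u, c = (p : ZMod (p ^ δ)) ^ (δ - 1) * u := by
    intro c hc
    have h1 : ((p * c.val : ℕ) : ZMod (p ^ δ)) = 0 := by
      push_cast
      rw [ZMod.natCast_zmod_val]
      exact hc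
    rw [ZMod.natCast_eq_zero_iff] at h1
    have h2 : p ^ (δ - 1) ∣ c.val := by
      apply Nat.dvd_of_mul_dvd_mul_left hp.pos
      rwa [← pow_succ', Nat.sub_add_cancel hδ]
    obtain ⟨u, hu⟩ := h2
    refine ⟨(u : ZMod (p ^ δ)), ?_⟩
    rw [← ZMod.natCast_zmod_val c, hu]
    push_cast
    rfl
  have hp0 : (p : ZMod (p ^ δ)) ^ δ = 0 := by
    rw [← Nat.cast_pow, ZMod.natCast_self]
  apply le_antisymm
  · obtain ⟨v, hv⟩ := exists_linearIndependent_of_le_finrank (R := ZMod (p ^ δ)) (M := N) le_rfl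
    have hli : LinearIndependent (ZMod (p ^ δ)) fun i => (e (v i)).1 := by
      rw [Fintype.linearIndependent_iff]
      intro c hc
      by_contra! hne
      have hex : ∃ k, ∀ i, (p : ZMod (p ^ δ)) ^ k * c i = 0 := ⟨δ, fun i => by rw [hp0, zero_mul]⟩
      classical
      have hk := Nat.find_spec hex
      have hk0 : Nat.find hex ≠ 0 := by
        intro h0
        rw [h0] at hk
        obtain ⟨i, hi⟩ := hne
        exact hi (by simpa using hk i)
      obtain ⟨k, hkk⟩ : ∃ k, Nat.find hex = k + 1 := ⟨Nat.find hex - 1, by omega⟩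
      have hmin := Nat.find_min hex (m := k) (by omega)
      apply hmin
      rw [hkk] at hk
      have hsum : ∑ i, ((p : ZMod (p ^ δ)) ^ k * c i) • v i = 0 := by
        apply e.injective
        rw [map_zero, map_sum]
        ext1
        · rw [Prod.fst_sum]
          simp only [map_smul, Prod.smul_fst, mul_smul]
          rw [← Finset.smul_sum, hc, smul_zero]
          rfl
        · rw [Prod.snd_sum]
          refine Finset.sum_eq_zero fun i _ => ?_
          obtain ⟨u, hu⟩ := key ((p : ZMod (p ^ δ)) ^ k * c i) (by
            rw [← mul_assoc, ← pow_succ']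
            exact hk i)
          rw [hu, map_smul, Prod.smul_snd, mul_smul, hK]
      exact Fintype.linearIndependent_iff.1 hv _ hsum
    simpa using hli.fintype_card_le_finrank
  · have hinj : Function.Injective
        (e.symm.toLinearMap ∘ₗ LinearMap.inl (ZMod (p ^ δ)) (Fin r → ZMod (p ^ δ)) K) :=
      e.symm.injective.comp LinearMap.inl_injective
    simpa using LinearMap.finrank_le_finrank_of_injective hinj

/-- `Hilb(M_G, t) = ∑_d rank (M_G)_d t^d` for `M = (ℤ/p^δ)[X, Y]` and `G = SL₂(ℤ/p^δ)`, where
`rank` is the rank of the free part over `ℤ/p^δ` (see `finrank_eq_rank_free_part`). -/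
def coinvariantsHilb (p δ : ℕ) : PowerSeries ℚ :=
  PowerSeries.mk fun d =>
    (Module.finrank (ZMod (p ^ δ)) (coinvariantsDegree (ZMod (p ^ δ)) d) : ℚ)

end

/-! Over `ℤ/p^δ`, which is self-injective, the rank of the free part of a finite module is the
dimension over `𝔽_p` of the space of functionals modulo `p` that lift modulo `p^δ`
(`finrank_eq_card_of_functionals`). So the task is to find which functionals modulo `p` on binary
forms of degree `d` are reductions of functionals that are `G`-invariant modulo `p^δ`. The group is
generated by one transvection and the Weyl element, so invariance amounts to two families of
congruences on the values at monomials. Forms are dehomogenised at `X = 1`, and functionals are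
lifted to integer values, so that the same functional can be reduced modulo different powers of `p`
and divided by `p`.

The Dickson invariants `L` and `Q`, of degrees `p + 1` and `p (p - 1)`, are invariant modulo `p`;
hence with `q = p^(δ-1)` the powers `L^(q i)` and `Q^(q j)` are invariant modulo `p^δ`. They are
coprime modulo `p^δ`, so `1 / (L^(q i) Q^(q j))` is a class in local cohomology, that is, a
functional on forms of degree `q (i (p + 1) + j p (p - 1)) - 2`. Up to scalars it is the only
functional there that annihilates the multiples of `L^(q i)` and of `Q^(q j)`, and this uniqueness
makes it invariant. For `δ ≥ 2` and `d ≥ 1` the reductions of these classes, with `i, j ≥ 1`, form a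
basis of the liftable functionals modulo `p`. Counting the pairs `(i, j)` gives the fraction; degree
`0` gives the summand `1`.

Independence is triangular in `i`. Spanning starts with a classification modulo `p`
(`exists_residueSpan_add_lineCoeff`): by induction on `d`, transposing multiplication by `L`, every
invariant functional is a combination of classes `1 / (L^i Q^j)` plus a multiple of an exceptional
functional, the sum of values over the plane, in degrees `(p - 1)(m + 1)` with `p ∤ m`.

To gain a power of `p`, compare `f` with its translate by `p`: invariance modulo `p^(δ+1)` forces
`φ(f') ≡ 0` modulo `p^δ` (`pow_dvd_succ_mul_apply`). Thus modulo `p` the functional lives on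
exponents `≡ -1` modulo `p`, and it is the Frobenius image of its Cartier transform, which is
invariant modulo `p^δ` (`cartierFunctional_mem`). Frobenius sends residue classes to multiples of
residue classes, while the Frobenius twist of an exceptional functional does not lift even modulo
`p^2` (`dvd_of_eq_mul_frobenius_lineCoeff`). Induction on the exponent of `p` finishes the proof. -/

noncomputable section

open Polynomial

/-! ### The reflection of binary forms -/

/-- Substitution `f ↦ f(-1/Y) Y ^ d` on polynomials of degree at most `d`, up to the sign
`(-1) ^ d`: it sends `Y ^ k` to `(-1) ^ k Y ^ (d - k)`. -/
def signedReflect (d : ℕ) : ℤ[X] →ₗ[ℤ] ℤ[X] where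
  toFun f := reflect d (f.comp (-X))
  map_add' f g := by rw [add_comp, reflect_add]
  map_smul' c f := by
    rw [smul_comp, smul_eq_C_mul, reflect_C_mul, smul_eq_C_mul, RingHom.id_apply]

theorem signedReflect_apply (d : ℕ) (f : ℤ[X]) :
    signedReflect d f = reflect d (f.comp (-X)) := rfl

theorem signedReflect_X_pow {d k : ℕ} (hk : k ≤ d) :
    signedReflect d (X ^ k) = C ((-1) ^ k) * X ^ (d - k) := by
  rw [signedReflect_apply, X_pow_comp, neg_pow, ← revAt_le hk, ← reflect_C_mul_X_pow, map_pow,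
    map_neg, map_one]

theorem natDegree_comp_neg_X_le {d : ℕ} {f : ℤ[X]} (hf : f.natDegree ≤ d) :
    (f.comp (-X)).natDegree ≤ d := by
  refine natDegree_comp_le.trans ?_
  rwa [natDegree_neg, natDegree_X, mul_one]

theorem signedReflect_mul {a d : ℕ} {f g : ℤ[X]} (hf : f.natDegree ≤ a) (hg : g.natDegree ≤ d) :
    signedReflect (a + d) (f * g) = signedReflect a f * signedReflect d g := by
  rw [signedReflect_apply, mul_comp,
    reflect_mul _ _ (natDegree_comp_neg_X_le hf) (natDegree_comp_neg_X_le hg)]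
  rfl

theorem natDegree_signedReflect_le {d : ℕ} {f : ℤ[X]} (hf : f.natDegree ≤ d) :
    (signedReflect d f).natDegree ≤ d := by
  rw [signedReflect_apply]
  refine natDegree_reflect_le.trans (max_le le_rfl (natDegree_comp_neg_X_le hf))

theorem signedReflect_pow {a : ℕ} {f : ℤ[X]} (hf : f.natDegree ≤ a) (hr : signedReflect a f = f)
    (i : ℕ) : signedReflect (i * a) (f ^ i) = f ^ i := by
  induction i with
  | zero => simp [signedReflect_apply]
  | succ i ih =>
    rw [pow_succ, add_mul, one_mul, signedReflect_mul _ hf, ih, hr]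
    exact natDegree_pow_le_of_le i hf

/-- As a form of degree `d + 1`, the polynomial `f` acquires a factor `X`, which the reflection
turns into `Y`. -/
theorem X_mul_signedReflect {d : ℕ} {f : ℤ[X]} (hf : f.natDegree ≤ d) :
    X * signedReflect d f = signedReflect (d + 1) f := by
  have h := signedReflect_mul (a := d) (d := 1) (g := 1) hf (by simp)
  rw [mul_one, signedReflect_apply 1, one_comp, reflect_one, pow_one] at h
  rw [h, mul_comm]

/-! ### Functionals on binary forms that are invariant modulo `n` -/

section Functional

variable {n : ℤ} {d : ℕ} {φ : ℤ[X] →ₗ[ℤ] ℤ}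

theorem dvd_apply_of_C_dvd {f : ℤ[X]} (φ : ℤ[X] →ₗ[ℤ] ℤ) (h : C n ∣ f) : n ∣ φ f := by
  obtain ⟨g, rfl⟩ := h
  rw [← smul_eq_C_mul, map_smul, smul_eq_mul]
  exact dvd_mul_right _ _

theorem dvd_apply_sub {f g : ℤ[X]} (φ : ℤ[X] →ₗ[ℤ] ℤ) (h : C n ∣ f - g) :
    n ∣ φ f - φ g := by
  rw [← map_sub]
  exact dvd_apply_of_C_dvd φ h

theorem dvd_apply_of_dvd_X_pow (h : ∀ k ≤ d, n ∣ φ (X ^ k)) {f : ℤ[X]} (hf : f.natDegree ≤ d) :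
    n ∣ φ f := by
  rw [f.as_sum_range' (d + 1) (by omega), map_sum]
  refine Finset.dvd_sum fun k hk => ?_
  rw [← C_mul_X_pow_eq_monomial, ← smul_eq_C_mul, map_smul, smul_eq_mul]
  exact (h k (by simpa [Nat.lt_succ_iff] using hk)).mul_left _

/-- The functionals on integral polynomials of degree at most `d`, seen as binary forms of
degree `d`, that are invariant modulo `n` under the substitutions
`(X, Y) ↦ (X, X + Y)` and `(X, Y) ↦ (Y, -X)`. -/
def invariantFunctionals (n : ℤ) (d : ℕ) : Submodule ℤ (ℤ[X] →ₗ[ℤ] ℤ) where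
  carrier := {φ | (∀ f : ℤ[X], f.natDegree ≤ d → n ∣ φ (taylor 1 f) - φ f) ∧
    ∀ f : ℤ[X], f.natDegree ≤ d → n ∣ φ (signedReflect d f) - φ f}
  zero_mem' := by simp
  add_mem' := by
    rintro φ ψ ⟨h1, h2⟩ ⟨h3, h4⟩
    refine ⟨fun f hf => ?_, fun f hf => ?_⟩
    · rw [LinearMap.add_apply, LinearMap.add_apply, add_sub_add_comm]
      exact dvd_add (h1 f hf) (h3 f hf)
    · rw [LinearMap.add_apply, LinearMap.add_apply, add_sub_add_comm]
      exact dvd_add (h2 f hf) (h4 f hf)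
  smul_mem' := by
    rintro c φ ⟨h1, h2⟩
    refine ⟨fun f hf => ?_, fun f hf => ?_⟩
    · rw [LinearMap.smul_apply, LinearMap.smul_apply, ← smul_sub]
      exact (h1 f hf).mul_left c
    · rw [LinearMap.smul_apply, LinearMap.smul_apply, ← smul_sub]
      exact (h2 f hf).mul_left c

theorem mem_invariantFunctionals_iff : φ ∈ invariantFunctionals n d ↔
    (∀ k ≤ d, n ∣ φ ((X + 1) ^ k) - φ (X ^ k)) ∧
      ∀ k ≤ d, n ∣ φ (X ^ k) - (-1) ^ k * φ (X ^ (d - k)) := by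
  constructor
  · rintro ⟨h1, h2⟩
    refine ⟨fun k hk => ?_, fun k hk => ?_⟩
    · simpa [taylor_X_pow] using h1 (X ^ k) (by simpa using hk)
    · have h := h2 (X ^ k) (by simpa using hk)
      rw [signedReflect_X_pow hk, ← smul_eq_C_mul, map_smul, smul_eq_mul] at h
      rwa [dvd_sub_comm]
  · rintro ⟨h1, h2⟩
    refine ⟨fun f hf => ?_, fun f hf => ?_⟩
    · refine dvd_apply_of_dvd_X_pow (φ := φ ∘ₗ taylor 1 - φ) (fun k hk => ?_) hf
      simpa [taylor_X_pow] using h1 k hk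
    · refine dvd_apply_of_dvd_X_pow (φ := φ ∘ₗ signedReflect d - φ) (fun k hk => ?_) hf
      rw [LinearMap.sub_apply, LinearMap.comp_apply, signedReflect_X_pow hk, ← smul_eq_C_mul,
        map_smul, smul_eq_mul, dvd_sub_comm]
      exact h2 k hk

theorem invariantFunctionals_mono {m : ℤ} (h : m ∣ n) :
    invariantFunctionals n d ≤ invariantFunctionals m d := by
  rintro φ ⟨h1, h2⟩
  exact ⟨fun f hf => h.trans (h1 f hf), fun f hf => h.trans (h2 f hf)⟩

/-- Multiplication by an invariant form of degree `a` is equivariant, so its transpose maps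
invariant functionals to invariant functionals of degree lower by `a`. -/
theorem mulLeft_mem_invariantFunctionals {a : ℕ} {A : ℤ[X]} (hA : A.natDegree ≤ a)
    (hT : C n ∣ taylor 1 A - A) (hR : signedReflect a A = A)
    (hφ : φ ∈ invariantFunctionals n (a + d)) :
    φ ∘ₗ LinearMap.mulLeft ℤ A ∈ invariantFunctionals n d := by
  obtain ⟨h1, h2⟩ := hφ
  have hdeg : ∀ f : ℤ[X], f.natDegree ≤ d → (A * f).natDegree ≤ a + d := fun f hf =>
    natDegree_mul_le_of_le hA hf
  refine ⟨fun f hf => ?_, fun f hf => ?_⟩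
  · have h3 := h1 _ (hdeg f hf)
    have h4 : n ∣ φ (taylor 1 A * taylor 1 f) - φ (A * taylor 1 f) :=
      dvd_apply_sub φ (by rw [← sub_mul]; exact hT.mul_right _)
    rw [taylor_mul] at h3
    simpa using dvd_sub h3 h4
  · have h3 := h2 _ (hdeg f hf)
    rw [signedReflect_mul hA hf, hR] at h3
    exact h3

end Functional

/-! ### The Dickson invariants -/

theorem C_dvd_iff_map_eq_zero {n : ℕ} {f : ℤ[X]} :
    C (n : ℤ) ∣ f ↔ f.map (Int.castRingHom (ZMod n)) = 0 := by
  rw [C_dvd_iff_dvd_coeff, Polynomial.ext_iff]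
  simp [ZMod.intCast_zmod_eq_zero_iff_dvd]

theorem C_dvd_sub_iff_map_eq {n : ℕ} {f g : ℤ[X]} :
    C (n : ℤ) ∣ f - g ↔ f.map (Int.castRingHom (ZMod n)) = g.map (Int.castRingHom (ZMod n)) := by
  rw [C_dvd_iff_map_eq_zero, Polynomial.map_sub, sub_eq_zero]

/-- The Dickson invariant `X Y ^ p - X ^ p Y` at `X = 1`. -/
def dicksonL (p : ℕ) : ℤ[X] := X ^ p - X

/-- The Dickson invariant `∑ X ^ ((p - 1) (p - i)) Y ^ ((p - 1) i)` at `X = 1`. -/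
def dicksonQ (p : ℕ) : ℤ[X] := ∑ i ∈ Finset.range (p + 1), X ^ ((p - 1) * i)

theorem dicksonL_mul_dicksonQ {p : ℕ} (hp : 1 ≤ p) :
    dicksonL p * dicksonQ p = X ^ (p ^ 2) - X := by
  obtain ⟨m, rfl⟩ : ∃ m, p = m + 1 := ⟨p - 1, by omega⟩
  have h := mul_geom_sum (X ^ m : ℤ[X]) (m + 1 + 1)
  have h2 : dicksonL (m + 1) = X * (X ^ m - 1) := by rw [dicksonL]; ring
  have h3 : dicksonQ (m + 1) = ∑ i ∈ Finset.range (m + 1 + 1), (X ^ m : ℤ[X]) ^ i := by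
    simp [dicksonQ, pow_mul]
  rw [h2, h3, mul_assoc, h]
  ring

section Dickson

variable {p : ℕ}

theorem natDegree_X_pow_sub_X (hp : 1 < p) : (X ^ p - X : ℤ[X]).natDegree = p := by
  rw [natDegree_sub_eq_left_of_natDegree_lt, natDegree_X_pow]
  rwa [natDegree_X, natDegree_X_pow]

theorem natDegree_dicksonL (hp : 1 < p) : (dicksonL p).natDegree = p :=
  natDegree_X_pow_sub_X hp

theorem natDegree_dicksonL_le (p : ℕ) : (dicksonL p).natDegree ≤ p + 1 := by
  refine (natDegree_sub_le _ _).trans (max_le ?_ ?_)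
  · rw [natDegree_X_pow]
    omega
  · rw [natDegree_X]
    omega

theorem dicksonQ_natDegree_monic (hp : 1 < p) :
    (dicksonQ p).natDegree = p * (p - 1) ∧ (dicksonQ p).Monic := by
  have h := dicksonL_mul_dicksonQ hp.le
  have h1 : (X ^ (p ^ 2) - X : ℤ[X]).Monic := by
    apply monic_X_pow_sub
    rw [degree_X]
    have : 1 < p ^ 2 := Nat.one_lt_pow (by norm_num) hp
    exact_mod_cast this
  have h2 : (dicksonL p).Monic := by
    apply monic_X_pow_sub
    rw [degree_X]
    exact_mod_cast hp
  rw [← h] at h1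
  have h3 := h2.of_mul_monic_left h1
  refine ⟨?_, h3⟩
  have h4 := h2.natDegree_mul h3
  rw [h, natDegree_dicksonL hp, natDegree_X_pow_sub_X
    (Nat.one_lt_pow (by norm_num) hp)] at h4
  rw [Nat.mul_sub, mul_one, ← pow_two]
  omega

theorem natDegree_dicksonQ (hp : 1 < p) : (dicksonQ p).natDegree = p * (p - 1) :=
  (dicksonQ_natDegree_monic hp).1

theorem monic_dicksonQ (hp : 1 < p) : (dicksonQ p).Monic := (dicksonQ_natDegree_monic hp).2

theorem signedReflect_dicksonL (hp : Odd p) : signedReflect (p + 1) (dicksonL p) = dicksonL p := by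
  have h := signedReflect_X_pow (d := p + 1) (k := 1) (by omega)
  rw [dicksonL, map_sub, signedReflect_X_pow (by omega)]
  rw [pow_one] at h
  rw [h, hp.neg_one_pow]
  simp
  ring

theorem signedReflect_dicksonQ (hp : Odd p) :
    signedReflect (p * (p - 1)) (dicksonQ p) = dicksonQ p := by
  rw [dicksonQ, map_sum, ← Finset.sum_range_reflect]
  refine Finset.sum_congr rfl fun i hi => ?_
  have hi : i ≤ p := by simpa [Nat.lt_succ_iff] using hi
  have he : p + 1 - 1 - i = p - i := by omega
  have h1 : (p - 1) * (p - i) ≤ p * (p - 1) := by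
    rw [mul_comm p]; exact Nat.mul_le_mul_left _ (by omega)
  have h2 : Even ((p - 1) * (p - i)) := Even.mul_right (hp.tsub_odd odd_one) _
  have h3 : p * (p - 1) - (p - 1) * (p - i) = (p - 1) * i := by
    rw [mul_comm p, ← Nat.mul_sub]
    congr 1
    omega
  rw [he, signedReflect_X_pow h1, h2.neg_one_pow, h3, map_one, one_mul]

theorem C_dvd_taylor_dicksonL (hp : p.Prime) :
    C (p : ℤ) ∣ taylor 1 (dicksonL p) - dicksonL p := by
  have : Fact p.Prime := ⟨hp⟩
  rw [C_dvd_sub_iff_map_eq, map_taylor, dicksonL]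
  simp [add_pow_char]

/-- Both `L` and `L Q = X^(p^2) - X` are translation invariant modulo `p`, and `L` can be cancelled
in the domain `𝔽_p[X]`. -/
theorem C_dvd_taylor_dicksonQ (hp : p.Prime) :
    C (p : ℤ) ∣ taylor 1 (dicksonQ p) - dicksonQ p := by
  have : Fact p.Prime := ⟨hp⟩
  have hL := C_dvd_sub_iff_map_eq.1 (C_dvd_taylor_dicksonL hp)
  have h := dicksonL_mul_dicksonQ hp.one_le
  have h2 : taylor 1 (dicksonL p * dicksonQ p) = taylor 1 (X ^ (p ^ 2) - X) := by rw [h]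
  have h3 := congrArg (Polynomial.map (Int.castRingHom (ZMod p))) h
  have h4 := congrArg (Polynomial.map (Int.castRingHom (ZMod p))) h2
  rw [taylor_mul, Polynomial.map_mul, hL] at h4
  rw [Polynomial.map_mul] at h3
  have h5 : Polynomial.map (Int.castRingHom (ZMod p)) (taylor 1 (X ^ (p ^ 2) - X)) =
      Polynomial.map (Int.castRingHom (ZMod p)) (X ^ (p ^ 2) - X) := by
    simp [add_pow_char_pow]
  rw [h5, ← h3] at h4
  rw [C_dvd_sub_iff_map_eq]
  refine mul_left_cancel₀ ?_ h4
  rw [dicksonL, Polynomial.map_sub, Polynomial.map_pow, map_X]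
  exact FiniteField.X_pow_card_sub_X_ne_zero _ hp.one_lt

/-- Each `p`-th power improves a congruence modulo `p^k` to one modulo `p^(k+1)`. -/
theorem C_dvd_taylor_pow {A : ℤ[X]} (h : C (p : ℤ) ∣ taylor 1 A - A) (k i : ℕ) :
    C ((p ^ (k + 1) : ℕ) : ℤ) ∣ taylor 1 (A ^ (p ^ k * i)) - A ^ (p ^ k * i) := by
  rw [taylor_pow, pow_mul, pow_mul A]
  refine dvd_trans ?_ (sub_dvd_pow_sub_pow _ _ i)
  have h' := dvd_sub_pow_of_dvd_sub (R := ℤ[X]) (p := p) (by simpa using h) k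
  simpa using h'

/-- The factors of `L = X (X^(p-1) - 1)` are coprime to `Q` modulo `p^δ`: the constant term of `Q`
is `1`, and `Q ≡ p + 1`, a unit, modulo `X^(p-1) - 1`. -/
theorem exists_dickson_bezout (hp : p.Prime) (δ i j : ℕ) :
    ∃ u v w : ℤ[X], dicksonL p ^ i * u + dicksonQ p ^ j * v = 1 + C ((p ^ δ : ℕ) : ℤ) * w := by
  set f := Int.castRingHom (ZMod (p ^ δ))
  obtain ⟨m, hm⟩ : ∃ m, p = m + 2 := ⟨p - 2, by have := hp.two_le; omega⟩
  have hX : IsCoprime (X : (ZMod (p ^ δ))[X]) ((dicksonQ p).map f) := by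
    refine ⟨-∑ i ∈ Finset.range p, X ^ ((p - 1) * (i + 1) - 1), 1, ?_⟩
    rw [dicksonQ, Finset.sum_range_succ', Polynomial.map_add, Polynomial.map_sum, neg_mul,
      Finset.sum_mul, one_mul]
    have : ∀ i, (X : (ZMod (p ^ δ))[X]) ^ ((p - 1) * (i + 1) - 1) * X =
        Polynomial.map f (X ^ ((p - 1) * (i + 1))) := by
      intro i
      rw [← pow_succ, Polynomial.map_pow, map_X]
      congr 1
      have : 0 < (p - 1) * (i + 1) := Nat.mul_pos (by omega) (by omega)
      omega
    simp only [this]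
    simp
  have hZ : IsCoprime (X ^ (p - 1) - 1 : (ZMod (p ^ δ))[X]) ((dicksonQ p).map f) := by
    have hu : IsUnit ((p : ZMod (p ^ δ)) + 1) := by
      have : IsUnit (((p + 1 : ℕ)) : ZMod (p ^ δ)) := by
        rw [ZMod.isUnit_iff_coprime]
        exact Nat.Coprime.pow_right _ (by simp)
      simpa using this
    have hs : (X ^ (p - 1) - 1 : (ZMod (p ^ δ))[X]) ∣
        (dicksonQ p).map f - C ((p : ZMod (p ^ δ)) + 1) := by
      have : (dicksonQ p).map f - C ((p : ZMod (p ^ δ)) + 1) =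
          ∑ i ∈ Finset.range (p + 1), ((X ^ (p - 1)) ^ i - 1) := by
        rw [dicksonQ, Polynomial.map_sum, Finset.sum_sub_distrib]
        simp [pow_mul]
      rw [this]
      refine Finset.dvd_sum fun i _ => ?_
      simpa using sub_dvd_pow_sub_pow (X ^ (p - 1) : (ZMod (p ^ δ))[X]) 1 i
    obtain ⟨h, hh⟩ := hs
    rw [sub_eq_iff_eq_add'] at hh
    rw [hh]
    have : IsUnit (C ((p : ZMod (p ^ δ)) + 1)) := hu.map C
    exact IsCoprime.add_mul_left_right
      ((isUnit_iff_dvd_one.1 this).elim fun c hc => ⟨0, c, by rw [hc]; ring⟩) h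
  have hL : IsCoprime ((dicksonL p).map f) ((dicksonQ p).map f) := by
    have : (dicksonL p).map f = X * (X ^ (p - 1) - 1) := by
      rw [dicksonL, Polynomial.map_sub, Polynomial.map_pow, map_X, mul_sub, mul_one, ← pow_succ',
        Nat.sub_add_cancel hp.one_le]
    rw [this]
    exact hX.mul_left hZ
  obtain ⟨u, v, huv⟩ := hL.pow (m := i) (n := j)
  have hsurj := Polynomial.map_surjective f (ZMod.intCast_surjective (n := p ^ δ))
  obtain ⟨u, rfl⟩ := hsurj u
  obtain ⟨v, rfl⟩ := hsurj v
  have : C ((p ^ δ : ℕ) : ℤ) ∣ dicksonL p ^ i * u + dicksonQ p ^ j * v - 1 := by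
    rw [C_dvd_sub_iff_map_eq]
    simp only [Polynomial.map_add, Polynomial.map_mul, Polynomial.map_pow, Polynomial.map_one]
    rw [← huv]
    ring
  obtain ⟨w, hw⟩ := this
  exact ⟨u, v, w, by rw [← hw]; ring⟩

end Dickson

/-! ### The residue functionals of `1 / (L^i Q^j)` -/

/-- The functionals on binary forms of degree `i (p + 1) + j p (p - 1) - 2` that annihilate the
multiples of `L ^ i` and `Q ^ j` modulo `n`, normalised to take the value `1` at
`L ^ i Y ^ (j p (p - 1) - 1) / X`. Every functional with the first two properties is a multiple. -/
structure IsDicksonResidue (p : ℕ) (n : ℤ) (i j : ℕ) (φ : ℤ[X] →ₗ[ℤ] ℤ) : Prop where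
  dvd_dicksonL : ∀ f : ℤ[X], f.natDegree + 2 ≤ j * (p * (p - 1)) → n ∣ φ (dicksonL p ^ i * f)
  dvd_dicksonQ : ∀ f : ℤ[X], n ∣ φ (dicksonQ p ^ j * f)
  normalized : n ∣ φ (dicksonL p ^ i * X ^ (j * (p * (p - 1)) - 1)) - 1
  unique : ∀ m : ℤ, m ∣ n → ∀ ψ : ℤ[X] →ₗ[ℤ] ℤ,
    (∀ f : ℤ[X], f.natDegree + 2 ≤ j * (p * (p - 1)) → m ∣ ψ (dicksonL p ^ i * f)) →
    (∀ f : ℤ[X], f.natDegree + 2 ≤ i * (p + 1) → m ∣ ψ (dicksonQ p ^ j * f)) →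
    ∀ f : ℤ[X], f.natDegree + 2 ≤ i * (p + 1) + j * (p * (p - 1)) →
      m ∣ ψ f - ψ (dicksonL p ^ i * X ^ (j * (p * (p - 1)) - 1)) * φ f

theorem exists_isDicksonResidue {p : ℕ} (hp : p.Prime) (δ : ℕ) {i j : ℕ} (hi : 1 ≤ i)
    (hj : 1 ≤ j) : ∃ φ, IsDicksonResidue p ((p ^ δ : ℕ) : ℤ) i j φ := by
  obtain ⟨u, v, w, huv⟩ := exists_dickson_bezout hp δ i j
  set n : ℤ := ((p ^ δ : ℕ) : ℤ)
  set b := j * (p * (p - 1)) with hb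
  set B := dicksonQ p ^ j with hBdef
  set A := dicksonL p ^ i with hAdef
  have hB : B.Monic := (monic_dicksonQ hp.one_lt).pow j
  have hBdeg : B.natDegree = b := by
    rw [hBdef, (monic_dicksonQ hp.one_lt).natDegree_pow, natDegree_dicksonQ hp.one_lt]
  have hAdeg : A.natDegree ≤ i * p := by
    refine natDegree_pow_le_of_le i ?_
    rw [natDegree_dicksonL hp.one_lt]
  have hb2 : 2 ≤ b := by
    have h1 : 2 ≤ p * (p - 1) := by
      have := hp.two_le
      exact Nat.mul_le_mul this (by omega : 1 ≤ p - 1)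
    exact h1.trans (Nat.le_mul_of_pos_left _ hj)
  have hBdeg' : B.degree = b := by rw [degree_eq_natDegree hB.ne_zero, hBdeg]
  have hB1 : B ≠ 1 := by
    intro h
    rw [h, natDegree_one] at hBdeg
    omega
  have hmodlt : ∀ f : ℤ[X], (f %ₘ B).natDegree < b := fun f => by
    rw [← hBdeg]
    exact natDegree_modByMonic_lt f hB hB1
  set φ : ℤ[X] →ₗ[ℤ] ℤ := lcoeff ℤ (b - 1) ∘ₗ modByMonicHom B ∘ₗ LinearMap.mulLeft ℤ u with hφ
  have hφapp : ∀ f, φ f = ((u * f) %ₘ B).coeff (b - 1) := fun f => rfl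
  -- multiples of `A` reduce to the cofactor
  have hred : ∀ f : ℤ[X], f.natDegree < b → (u * (A * f)) %ₘ B = f + C n * (w * f %ₘ B) := by
    intro f hf
    have h1 : u * (A * f) = f + n • (w * f) - (v * f) * B := by
      rw [smul_eq_C_mul]
      linear_combination f * huv
    have h2 : (v * f * B) %ₘ B = 0 := (modByMonic_eq_zero_iff_dvd hB).2 (dvd_mul_left _ _)
    have h3 : f %ₘ B = f := by
      rw [modByMonic_eq_self_iff hB, hBdeg']
      exact degree_le_natDegree.trans_lt (by exact_mod_cast hf)
    rw [h1, sub_modByMonic, add_modByMonic, smul_modByMonic, h2, sub_zero, smul_eq_C_mul, h3]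
  have hdvd : ∀ f : ℤ[X], f.natDegree < b → n ∣ φ (A * f) - f.coeff (b - 1) := by
    intro f hf
    rw [hφapp, hred f hf, coeff_add, coeff_C_mul, add_sub_cancel_left]
    exact dvd_mul_right _ _
  refine ⟨φ, ⟨fun f hf => ?_, fun f => ?_, ?_, ?_⟩⟩
  · have h := hdvd f (by omega)
    rwa [coeff_eq_zero_of_natDegree_lt (by omega), sub_zero] at h
  · have : (u * (B * f)) %ₘ B = 0 :=
      (modByMonic_eq_zero_iff_dvd hB).2 ((dvd_mul_right _ _).mul_left _)
    rw [hφapp, this, coeff_zero]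
    exact dvd_zero _
  · have h := hdvd (X ^ (b - 1)) (by rw [natDegree_X_pow]; omega)
    rwa [coeff_X_pow_self] at h
  · intro m hm ψ h1 h2 f hf
    -- Since `g ≡ f / A` modulo `B`, the difference `f - A g` is a multiple of `B` modulo `n`, and
    -- `ψ` annihilates it modulo `m`. Only `A g` counts, and there only the top coefficient of `g`.
    set g := (u * f) %ₘ B with hg
    have hgb : g.natDegree < b := hmodlt _
    have hip : i * (p + 1) = i * p + i := by ring
    have hfg : (f - A * g).natDegree + 2 ≤ i * (p + 1) + b := by
      have h3 := natDegree_sub_le f (A * g)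
      have h4 : (A * g).natDegree ≤ i * p + (b - 1) := natDegree_mul_le_of_le hAdeg (by omega)
      rcases le_max_iff.1 h3 with h3 | h3 <;> omega
    have hdecomp := modByMonic_add_div (f - A * g) B
    have hr : C n ∣ (f - A * g) %ₘ B := by
      have h5 : A * u = 1 + n • w - v * B := by
        rw [smul_eq_C_mul, ← huv]; ring
      have h6 : u * f = g + B * ((u * f) /ₘ B) := (modByMonic_add_div _ B).symm
      have h7 : f - A * g = (v * f + A * ((u * f) /ₘ B)) * B - n • (w * f) := by
        have h8 : A * (u * f) = A * g + A * (B * ((u * f) /ₘ B)) := by rw [← mul_add, ← h6]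
        have h9 : A * (u * f) = (1 + n • w - v * B) * f := by rw [← h5]; ring
        rw [h9, smul_eq_C_mul] at h8
        rw [smul_eq_C_mul]
        linear_combination h8
      rw [h7, sub_modByMonic, (modByMonic_eq_zero_iff_dvd hB).2 (dvd_mul_left _ _), zero_sub,
        smul_modByMonic, smul_eq_C_mul]
      exact (dvd_mul_right _ _).neg_right
    have h8 : m ∣ ψ (B * ((f - A * g) /ₘ B)) := by
      refine h2 _ ?_
      rw [natDegree_divByMonic _ hB, hBdeg]
      have : 2 ≤ i * (p + 1) := Nat.mul_le_mul hi (by have := hp.one_le; omega : 2 ≤ p + 1)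
      omega
    have h9 : m ∣ ψ ((f - A * g) %ₘ B) := hm.trans (dvd_apply_of_C_dvd ψ hr)
    have hsplit : (g - g.coeff (b - 1) • X ^ (b - 1)).natDegree + 2 ≤ b := by
      have : (g - g.coeff (b - 1) • X ^ (b - 1)).natDegree ≤ b - 2 := by
        rw [natDegree_le_iff_coeff_eq_zero]
        intro N hN
        rw [coeff_sub, coeff_smul, coeff_X_pow]
        split_ifs with hN'
        · rw [hN']; simp
        · rw [coeff_eq_zero_of_natDegree_lt (by omega)]; simp
      omega
    have h10 := h1 _ hsplit
    have : ψ f - ψ (A * X ^ (b - 1)) * φ f = ψ ((f - A * g) %ₘ B) + ψ (B * ((f - A * g) /ₘ B)) +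
        ψ (A * (g - g.coeff (b - 1) • X ^ (b - 1))) := by
      rw [← map_add, hdecomp, mul_sub, mul_smul_comm, map_sub, map_sub, map_smul, smul_eq_mul,
        hφapp f]
      ring
    rw [this]
    exact dvd_add (dvd_add h9 h8) h10

/-- The class of `1 / (L ^ i Q ^ j)` in local cohomology modulo `p ^ δ`, as a functional. -/
def dicksonResidue (p δ i j : ℕ) : ℤ[X] →ₗ[ℤ] ℤ :=
  Classical.epsilon (IsDicksonResidue p ((p ^ δ : ℕ) : ℤ) i j)

theorem isDicksonResidue {p : ℕ} (hp : p.Prime) (δ : ℕ) {i j : ℕ} (hi : 1 ≤ i)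
    (hj : 1 ≤ j) : IsDicksonResidue p ((p ^ δ : ℕ) : ℤ) i j (dicksonResidue p δ i j) :=
  Classical.epsilon_spec (exists_isDicksonResidue hp δ hi hj)

theorem natDegree_X_add_one_pow_sub_le (k : ℕ) :
    ((X + 1 : ℤ[X]) ^ (k + 1) - X ^ (k + 1)).natDegree ≤ k := by
  rw [natDegree_le_iff_coeff_eq_zero]
  intro N hN
  rw [coeff_sub, coeff_X_add_one_pow, coeff_X_pow]
  split_ifs with h
  · rw [h]; simp
  · rw [Nat.choose_eq_zero_of_lt (by omega)]; simp

/-- The transforms of `φ` by the two generators still annihilate the multiples of `L^i` and `Q^j`,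
so by uniqueness they are multiples of `φ`. It remains to check that the normalisation is preserved.
-/
theorem IsDicksonResidue.mem_invariantFunctionals {p : ℕ} (hp : p.Prime) (hp2 : Odd p)
    {n : ℤ} {i j d : ℕ} {φ : ℤ[X] →ₗ[ℤ] ℤ} (hφ : IsDicksonResidue p n i j φ)
    (hi : 1 ≤ i) (hj : 1 ≤ j)
    (hL : C n ∣ taylor 1 (dicksonL p ^ i) - dicksonL p ^ i)
    (hQ : C n ∣ taylor 1 (dicksonQ p ^ j) - dicksonQ p ^ j)
    (hd : d + 2 = i * (p + 1) + j * (p * (p - 1))) :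
    φ ∈ invariantFunctionals n d := by
  set b := j * (p * (p - 1)) with hb
  have hb2 : 2 ≤ b := by
    have h1 : 2 ≤ p * (p - 1) := by
      have := hp.two_le
      exact Nat.mul_le_mul this (by omega : 1 ≤ p - 1)
    exact h1.trans (Nat.le_mul_of_pos_left _ hj)
  have hbe : Even b := (Even.mul_left (hp2.tsub_odd odd_one) p).mul_left j
  have hip : i * (p + 1) = i * p + i := by ring
  have hAdeg : (dicksonL p ^ i).natDegree ≤ i * (p + 1) :=
    natDegree_pow_le_of_le i (natDegree_dicksonL_le p)
  have hAdeg' : (dicksonL p ^ i).natDegree ≤ i * p :=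
    natDegree_pow_le_of_le i (natDegree_dicksonL hp.one_lt).le
  have hBdeg : (dicksonQ p ^ j).natDegree = b := by
    rw [(monic_dicksonQ hp.one_lt).natDegree_pow, natDegree_dicksonQ hp.one_lt]
  have hAR : signedReflect (i * (p + 1)) (dicksonL p ^ i) = dicksonL p ^ i :=
    signedReflect_pow (natDegree_dicksonL_le p) (signedReflect_dicksonL hp2) i
  have hBR : signedReflect b (dicksonQ p ^ j) = dicksonQ p ^ j :=
    signedReflect_pow (natDegree_dicksonQ hp.one_lt).le (signedReflect_dicksonQ hp2) j
  -- a functional that annihilates the multiples and takes the value `1` agrees with `φ`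
  have key : ∀ ψ : ℤ[X] →ₗ[ℤ] ℤ,
      (∀ f : ℤ[X], f.natDegree + 2 ≤ b → n ∣ ψ (dicksonL p ^ i * f)) →
      (∀ f : ℤ[X], f.natDegree + 2 ≤ i * (p + 1) → n ∣ ψ (dicksonQ p ^ j * f)) →
      n ∣ ψ (dicksonL p ^ i * X ^ (b - 1)) - 1 →
      ∀ f : ℤ[X], f.natDegree ≤ d → n ∣ ψ f - φ f := by
    intro ψ h1 h2 h3 f hf
    have h := hφ.unique n dvd_rfl ψ h1 h2 f (by omega)
    have h4 := h3.mul_right (φ f)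
    have : ψ f - φ f = (ψ f - ψ (dicksonL p ^ i * X ^ (b - 1)) * φ f) +
        (ψ (dicksonL p ^ i * X ^ (b - 1)) - 1) * φ f := by ring
    rw [this]
    exact dvd_add h h4
  refine ⟨key (φ ∘ₗ taylor 1) ?_ ?_ ?_, key (φ ∘ₗ signedReflect d) ?_ ?_ ?_⟩
  · intro f hf
    rw [LinearMap.comp_apply, taylor_mul]
    have h1 := hφ.dvd_dicksonL (taylor 1 f) (by rwa [natDegree_taylor])
    have h2 := dvd_apply_sub (n := n) (f := taylor 1 (dicksonL p ^ i) * taylor 1 f)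
      (g := dicksonL p ^ i * taylor 1 f) φ (by rw [← sub_mul]; exact hL.mul_right _)
    exact (dvd_iff_dvd_of_dvd_sub h2).2 h1
  · intro f hf
    rw [LinearMap.comp_apply, taylor_mul]
    have h1 := hφ.dvd_dicksonQ (taylor 1 f)
    have h2 := dvd_apply_sub (n := n) (f := taylor 1 (dicksonQ p ^ j) * taylor 1 f)
      (g := dicksonQ p ^ j * taylor 1 f) φ (by rw [← sub_mul]; exact hQ.mul_right _)
    exact (dvd_iff_dvd_of_dvd_sub h2).2 h1
  · rw [LinearMap.comp_apply, taylor_mul, taylor_X_pow, map_one]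
    have h2 := dvd_apply_sub (n := n) (f := taylor 1 (dicksonL p ^ i) * (X + 1) ^ (b - 1))
      (g := dicksonL p ^ i * (X + 1) ^ (b - 1)) φ (by rw [← sub_mul]; exact hL.mul_right _)
    obtain ⟨c, hc⟩ : ∃ c, b = c + 2 := ⟨b - 2, by omega⟩
    -- Translation changes `X^(b-1)` by terms of degree at most `b - 2`, whose products with `L^i`
    -- are annihilated.
    have h3 := natDegree_X_add_one_pow_sub_le c
    have h4 := hφ.dvd_dicksonL ((X + 1) ^ (c + 1) - X ^ (c + 1)) (by omega)
    have h5 := hφ.normalized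
    rw [← hb] at h5
    have hc1 : b - 1 = c + 1 := by omega
    rw [hc1] at h2 h5 ⊢
    rw [mul_sub, map_sub] at h4
    refine (dvd_add (dvd_add h2 h4) h5).trans (dvd_of_eq ?_)
    ring
  · intro f hf
    obtain ⟨e, he⟩ : ∃ e, b = e + 2 := ⟨b - 2, by omega⟩
    have hde : d = i * (p + 1) + e := by omega
    rw [LinearMap.comp_apply, hde, signedReflect_mul hAdeg (by omega), hAR]
    refine hφ.dvd_dicksonL _ ?_
    have := natDegree_signedReflect_le (d := e) (f := f) (by omega)
    omega
  · intro f hf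
    obtain ⟨e, he⟩ : ∃ e, i * (p + 1) = e + 2 := ⟨i * (p + 1) - 2, by omega⟩
    have hde : d = b + e := by omega
    rw [LinearMap.comp_apply, hde, signedReflect_mul hBdeg.le (by omega), hBR]
    exact hφ.dvd_dicksonQ _
  · obtain ⟨e, he⟩ : ∃ e, i * (p + 1) = e + 1 := ⟨i * (p + 1) - 1, by omega⟩
    obtain ⟨c, hc⟩ : ∃ c, b = c + 2 := ⟨b - 2, by omega⟩
    have hde : d = e + (c + 1) := by omega
    have hc1 : b - 1 = c + 1 := by omega
    have hco : Odd (c + 1) := by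
      rw [hc] at hbe
      rw [Nat.even_add] at hbe
      exact (hbe.2 even_two).add_one
    have hAe : (dicksonL p ^ i).natDegree ≤ e := by omega
    rw [LinearMap.comp_apply, hde, hc1, signedReflect_mul hAe (by simp),
      signedReflect_X_pow le_rfl, hco.neg_one_pow]
    set A' := signedReflect e (dicksonL p ^ i) with hA'
    have hXA : X * A' = dicksonL p ^ i := by
      rw [hA', X_mul_signedReflect hAe, ← he, hAR]
    have hA'deg : A'.natDegree ≤ e := natDegree_signedReflect_le hAe
    -- The reflected test element is `-A'` with `X A' = L^i`. Writing `Q^j = X^b + 1 + X h` gives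
    -- `-A' = L^i h + L^i X^(b-1) - Q^j A'`; the outer terms are annihilated and the middle one has
    -- value `1`.
    set h := divX (dicksonQ p ^ j - X ^ b - 1) with hh
    have hQ0 : (dicksonQ p ^ j).coeff 0 = 1 := by
      rw [coeff_zero_eq_eval_zero, eval_pow, dicksonQ, eval_finsetSum, Finset.sum_range_succ',
        Finset.sum_eq_zero]
      · simp
      · intro k _
        have : (p - 1) * (k + 1) ≠ 0 := by
          have := hp.two_le
          exact Nat.mul_ne_zero (by omega) (by omega)
        simp only [eval_pow, eval_X]
        exact zero_pow this
    have hXh : X * h = dicksonQ p ^ j - X ^ b - 1 := by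
      have h0 : (dicksonQ p ^ j - X ^ b - 1).coeff 0 = 0 := by
        rw [coeff_sub, coeff_sub, hQ0, coeff_X_pow, if_neg (by omega)]
        simp
      have := X_mul_divX_add (dicksonQ p ^ j - X ^ b - 1)
      rwa [h0, C_0, add_zero] at this
    have hhdeg : h.natDegree + 2 ≤ b := by
      have : (dicksonQ p ^ j - X ^ b - 1).natDegree ≤ b - 1 := by
        rw [natDegree_le_iff_coeff_eq_zero]
        intro N hN
        rw [coeff_sub, coeff_sub, coeff_X_pow, coeff_one, if_neg (by omega : N ≠ 0), sub_zero]
        split_ifs with hN'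
        · have := ((monic_dicksonQ hp.one_lt).pow j).coeff_natDegree
          rw [hBdeg] at this
          rw [hN', this, sub_self]
        · rw [coeff_eq_zero_of_natDegree_lt (by omega), sub_zero]
      rw [hh, natDegree_divX_eq_natDegree_tsub_one]
      omega
    have h1 := hφ.dvd_dicksonQ A'
    have h2 := hφ.dvd_dicksonL h hhdeg
    have h3 := hφ.normalized
    rw [← hb, hc1] at h3
    have h4 : A' * (C (-1) * X ^ (c + 1 - (c + 1))) =
        dicksonL p ^ i * h + dicksonL p ^ i * X ^ (c + 1) - dicksonQ p ^ j * A' := by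
      rw [← hXA]
      have : X * A' * h = A' * (dicksonQ p ^ j - X ^ b - 1) := by rw [← hXh]; ring
      rw [this, hc]
      simp only [map_neg, map_one, Nat.sub_self, pow_zero]
      ring
    rw [h4, map_sub, map_add]
    refine (dvd_sub (dvd_add h2 h3) h1).trans (dvd_of_eq ?_)
    ring

theorem dicksonResidue_mem {p : ℕ} (hp : p.Prime) (hp2 : Odd p) (k : ℕ) {i j d : ℕ}
    (hi : 1 ≤ i) (hj : 1 ≤ j)
    (hd : d + 2 = p ^ k * (i * (p + 1) + j * (p * (p - 1)))) :
    dicksonResidue p (k + 1) (p ^ k * i) (p ^ k * j) ∈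
      invariantFunctionals ((p ^ (k + 1) : ℕ) : ℤ) d := by
  have hq : 1 ≤ p ^ k := Nat.one_le_pow _ _ hp.pos
  have hi' : 1 ≤ p ^ k * i := Nat.mul_le_mul hq hi
  have hj' : 1 ≤ p ^ k * j := Nat.mul_le_mul hq hj
  refine (isDicksonResidue hp (k + 1) hi' hj').mem_invariantFunctionals hp hp2 hi' hj'
    (C_dvd_taylor_pow (C_dvd_taylor_dicksonL hp) k i)
    (C_dvd_taylor_pow (C_dvd_taylor_dicksonQ hp) k j) ?_
  rw [hd]
  ring

/-- This is `L^s · 1 / (L^(i+s) Q^j) = 1 / (L^i Q^j)`; it follows from uniqueness, because both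
sides have the same annihilation properties and normalisation. -/
theorem IsDicksonResidue.dvd_mul_dicksonL_sub {p : ℕ} {n m : ℤ} {i j s : ℕ}
    {φ φ' : ℤ[X] →ₗ[ℤ] ℤ} (hφ : IsDicksonResidue p n i j φ) {n' : ℤ}
    (hφ' : IsDicksonResidue p n' (i + s) j φ') (hm : m ∣ n) (hm' : m ∣ n') {f : ℤ[X]}
    (hf : f.natDegree + 2 ≤ i * (p + 1) + j * (p * (p - 1))) :
    m ∣ φ' (dicksonL p ^ s * f) - φ f := by
  have h := hφ.unique m hm (φ' ∘ₗ LinearMap.mulLeft ℤ (dicksonL p ^ s)) (fun g hg => ?_)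
    (fun g hg => ?_) f hf
  · have h1 := hm'.trans hφ'.normalized
    simp only [LinearMap.comp_apply, LinearMap.mulLeft_apply] at h
    rw [← mul_assoc, ← pow_add, add_comm s] at h
    refine (dvd_add h (h1.mul_right (φ f))).trans (dvd_of_eq ?_)
    ring
  · rw [LinearMap.comp_apply, LinearMap.mulLeft_apply, ← mul_assoc, ← pow_add, add_comm s]
    exact hm'.trans (hφ'.dvd_dicksonL g hg)
  · rw [LinearMap.comp_apply, LinearMap.mulLeft_apply, mul_left_comm]
    exact hm'.trans (hφ'.dvd_dicksonQ _)

theorem IsDicksonResidue.dvd_apply_dicksonL_pow_mul {p : ℕ} {n : ℤ} {i j s : ℕ}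
    {φ : ℤ[X] →ₗ[ℤ] ℤ} (hφ : IsDicksonResidue p n i j φ) (hs : i ≤ s) {f : ℤ[X]}
    (hf : f.natDegree + 2 + s * (p + 1) ≤ i * (p + 1) + j * (p * (p - 1))) :
    n ∣ φ (dicksonL p ^ s * f) := by
  obtain ⟨t, rfl⟩ := Nat.exists_eq_add_of_le hs
  rw [pow_add, mul_assoc]
  refine hφ.dvd_dicksonL _ ?_
  have h1 : (dicksonL p ^ t * f).natDegree ≤ t * (p + 1) + f.natDegree :=
    natDegree_mul_le_of_le (natDegree_pow_le_of_le t (natDegree_dicksonL_le p)) le_rfl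
  rw [add_mul] at hf
  omega

/-! ### Coefficients of invariant functionals modulo `p` -/

theorem apply_X_add_one_pow (φ : ℤ[X] →ₗ[ℤ] ℤ) (k : ℕ) :
    φ ((X + 1) ^ k) = ∑ m ∈ Finset.range (k + 1), (k.choose m : ℤ) * φ (X ^ m) := by
  rw [add_pow, map_sum]
  refine Finset.sum_congr rfl fun m _ => ?_
  rw [one_pow, mul_one, mul_comm, ← nsmul_eq_mul, map_nsmul, nsmul_eq_mul]

section Invariant

variable {n : ℤ} {d : ℕ} {φ : ℤ[X] →ₗ[ℤ] ℤ}

theorem dvd_sum_choose_mul (hφ : φ ∈ invariantFunctionals n d) {k : ℕ} (hk : k ≤ d) :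
    n ∣ ∑ m ∈ Finset.range k, (k.choose m : ℤ) * φ (X ^ m) := by
  have h := (mem_invariantFunctionals_iff.1 hφ).1 k hk
  rw [apply_X_add_one_pow, Finset.sum_range_succ, Nat.choose_self, Nat.cast_one, one_mul,
    add_sub_cancel_right] at h
  exact h

theorem dvd_apply_X_pow_symm_iff (hφ : φ ∈ invariantFunctionals n d) {m : ℤ} (hm : m ∣ n)
    {k : ℕ} (hk : k ≤ d) : m ∣ φ (X ^ k) ↔ m ∣ φ (X ^ (d - k)) := by
  have h := (mem_invariantFunctionals_iff.1 hφ).2 k hk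
  rw [dvd_iff_dvd_of_dvd_sub (hm.trans h)]
  rcases neg_one_pow_eq_or ℤ k with h1 | h1 <;> simp [h1]

theorem dvd_apply_one (hφ : φ ∈ invariantFunctionals n d) (hd : 1 ≤ d) : n ∣ φ (X ^ 0) := by
  simpa using dvd_sum_choose_mul hφ hd

theorem dvd_apply_X_pow_top (hφ : φ ∈ invariantFunctionals n d) (hd : 1 ≤ d) :
    n ∣ φ (X ^ d) := by
  rw [dvd_apply_X_pow_symm_iff hφ dvd_rfl le_rfl, Nat.sub_self]
  exact dvd_apply_one hφ hd

variable {p : ℕ}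

/-- In the translation congruence for `X^(l+1)` the last term is `(l + 1) φ(X^l)`, with `l + 1` a
unit modulo `p`, and the other terms vanish by induction. The top exponent `l = d` needs the
reflection instead. -/
theorem dvd_apply_X_pow_of_low (hp : p.Prime) (hφ : φ ∈ invariantFunctionals p d) (hd : 1 ≤ d)
    {l : ℕ} (hl : l ≤ d) (hlp : l + 2 ≤ p) : (p : ℤ) ∣ φ (X ^ l) := by
  have hp' : Prime (p : ℤ) := Nat.prime_iff_prime_int.1 hp
  rcases hl.eq_or_lt with rfl | hl
  · exact dvd_apply_X_pow_top hφ hd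
  induction l using Nat.strong_induction_on with
  | _ l ih =>
    have h := dvd_sum_choose_mul hφ (k := l + 1) hl
    rw [Finset.sum_range_succ, Nat.choose_succ_self_right] at h
    have h1 : (p : ℤ) ∣ ∑ m ∈ Finset.range l, ((l + 1).choose m : ℤ) * φ (X ^ m) := by
      refine Finset.dvd_sum fun m hm => ?_
      rw [Finset.mem_range] at hm
      exact (ih m hm (by omega) (by omega) (by omega)).mul_left _
    have h2 := (dvd_add_right h1).1 h
    refine (hp'.dvd_mul.1 h2).resolve_left fun h3 => ?_
    have := Nat.le_of_dvd (by omega) (Int.natCast_dvd_natCast.1 h3)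
    omega

theorem dvd_apply_X_pow_of_high (hp : p.Prime) (hφ : φ ∈ invariantFunctionals p d) (hd : 1 ≤ d)
    {l : ℕ} (hl : l ≤ d) (hlp : d + 2 ≤ p + l) : (p : ℤ) ∣ φ (X ^ l) := by
  rw [dvd_apply_X_pow_symm_iff hφ dvd_rfl hl]
  exact dvd_apply_X_pow_of_low hp hφ hd (by omega) (by omega)

theorem dvd_apply_X_pow_of_degree_lt (hp : p.Prime) (hφ : φ ∈ invariantFunctionals p d)
    (hd : 1 ≤ d) (hdp : d + 3 ≤ 2 * p) {l : ℕ} (hl : l ≤ d) : (p : ℤ) ∣ φ (X ^ l) := by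
  by_cases h : l + 2 ≤ p
  · exact dvd_apply_X_pow_of_low hp hφ hd hl h
  · exact dvd_apply_X_pow_of_high hp hφ hd hl (by omega)

theorem apply_dicksonL_mul_X_pow (φ : ℤ[X] →ₗ[ℤ] ℤ) (p k : ℕ) :
    φ (dicksonL p * X ^ k) = φ (X ^ (k + p)) - φ (X ^ (k + 1)) := by
  rw [dicksonL, sub_mul, map_sub, ← pow_add, ← pow_succ', add_comm p]

/-- The coefficients of the functional that sums the values of a binary form of degree `d` over
all points of the plane over `𝔽_p`, for `d` divisible by `p - 1`. -/
def lineCoeff (p d k : ℕ) : ℤ := if (p - 1) ∣ k ∧ 0 < k ∧ k < d then 1 else 0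

/-- Annihilating the multiples of `L` makes the values periodic of period `p - 1` on interior
exponents. Those below `p - 1` vanish, so only multiples of `p - 1` survive, and the reflection
symmetry then forces `p - 1` to divide `d`. -/
theorem eq_lineCoeff_of_dvd_apply_dicksonL_mul (hp : p.Prime) (hp3 : 3 ≤ p)
    (hφ : φ ∈ invariantFunctionals p d) (hd : 1 ≤ d)
    (hL : ∀ k, k + p + 1 ≤ d → (p : ℤ) ∣ φ (dicksonL p * X ^ k)) :
    (∀ k ≤ d, (p : ℤ) ∣ φ (X ^ k)) ∨ ∃ m, 1 ≤ m ∧ d = (p - 1) * (m + 1) ∧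
      ∃ ε : ℤ, ∀ k ≤ d, (p : ℤ) ∣ φ (X ^ k) - ε * lineCoeff p d k := by
  set ε := φ (X ^ (p - 1)) with hε
  have key : ∀ k, 0 < k → k < d → (p : ℤ) ∣ φ (X ^ k) - (if (p - 1) ∣ k then ε else 0) := by
    intro k
    induction k using Nat.strong_induction_on with
    | _ k ih =>
      intro hk hkd
      rcases lt_trichotomy k (p - 1) with h | h | h
      · rw [if_neg (Nat.not_dvd_of_pos_of_lt hk h), sub_zero]
        exact dvd_apply_X_pow_of_low hp hφ hd hkd.le (by omega)
      · rw [h, if_pos dvd_rfl, sub_self]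
        exact dvd_zero _
      · have h1 := ih (k - (p - 1)) (by omega) (by omega) (by omega)
        have h2 := hL (k - p) (by omega)
        rw [apply_dicksonL_mul_X_pow, show k - p + p = k by omega,
          show k - p + 1 = k - (p - 1) by omega] at h2
        have h3 : (p - 1) ∣ k - (p - 1) ↔ (p - 1) ∣ k := Nat.dvd_sub_iff_left h.le dvd_rfl
        rw [if_congr h3 rfl rfl] at h1
        refine (dvd_add h2 h1).trans (dvd_of_eq ?_)
        ring
  have hbd : ∀ k ≤ d, ¬ (0 < k ∧ k < d) → (p : ℤ) ∣ φ (X ^ k) := by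
    intro k hk h
    rcases (by omega : k = 0 ∨ k = d) with rfl | rfl
    · exact dvd_apply_one hφ hd
    · exact dvd_apply_X_pow_top hφ hd
  by_cases hz : ∀ k ≤ d, (p : ℤ) ∣ φ (X ^ k)
  · exact Or.inl hz
  right
  have hε0 : ¬ (p : ℤ) ∣ ε := by
    intro h
    refine hz fun k hk => ?_
    by_cases h1 : 0 < k ∧ k < d
    · have h2 := key k h1.1 h1.2
      split_ifs at h2
      · exact (dvd_iff_dvd_of_dvd_sub h2).2 h
      · simpa using h2
    · exact hbd k hk h1
  have hpd : p - 1 < d := by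
    by_contra hcon
    refine hz fun k hk => dvd_apply_X_pow_of_degree_lt hp hφ hd (by omega) hk
  have h1 : (p - 1) ∣ d - (p - 1) := by
    by_contra hcon
    have h2 := key (d - (p - 1)) (by omega) (by omega)
    rw [if_neg hcon, sub_zero, ← dvd_apply_X_pow_symm_iff hφ dvd_rfl hpd.le] at h2
    exact hε0 h2
  obtain ⟨m, hm⟩ := h1
  have hm1 : 1 ≤ m := by
    rcases Nat.eq_zero_or_pos m with rfl | h
    · omega
    · exact h
  refine ⟨m, hm1, by rw [mul_add, mul_one, ← hm]; omega, ε, fun k hk => ?_⟩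
  rw [lineCoeff]
  by_cases h1 : 0 < k ∧ k < d
  · have h2 := key k h1.1 h1.2
    by_cases h3 : (p - 1) ∣ k
    · rw [if_pos h3] at h2
      rwa [if_pos ⟨h3, h1⟩, mul_one]
    · rw [if_neg h3] at h2
      rwa [if_neg (fun h => h3 h.1), mul_zero]
  · rw [if_neg (fun h => h1 h.2), mul_zero, sub_zero]
    exact hbd k hk h1

/-- The differences `φ(X^(k+p)) - φ(X^(k+1))` telescope along the exponents `≡ 1` modulo `p - 1`.
Both ends vanish, being next to the extreme exponents, and exactly `m` steps contribute `ε`. This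
obstructs lifting a line functional through `L` when `p ∤ m`. -/
theorem dvd_mul_of_dicksonL_mul_eq_lineCoeff (hp : p.Prime) (hp3 : 3 ≤ p) {m : ℕ}
    (hd : d = (p - 1) * (m + 1)) (hφ : φ ∈ invariantFunctionals p (p + 1 + d)) (ε : ℤ)
    (hL : ∀ k ≤ d, (p : ℤ) ∣ φ (dicksonL p * X ^ k) - ε * lineCoeff p d k) :
    (p : ℤ) ∣ ε * m := by
  have key : ∀ a : ℕ, a ≤ m → (p : ℤ) ∣ φ (X ^ ((p - 1) * (a + 1) + 1)) - ε * a := by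
    intro a
    induction a with
    | zero =>
      intro _
      have h := hL 0 (by omega)
      have h1 := dvd_apply_X_pow_of_low hp hφ (by omega) (l := 1) (by omega) (by omega)
      rw [apply_dicksonL_mul_X_pow, lineCoeff, if_neg (by simp), mul_zero, sub_zero] at h
      have h2 := (dvd_iff_dvd_of_dvd_sub h).2 h1
      rw [zero_add, mul_one, Nat.cast_zero, mul_zero, sub_zero,
        show p - 1 + 1 = 0 + p by omega]
      exact h2
    | succ a ih =>
      intro ha
      have hlt : (p - 1) * (a + 1) < d := by
        rw [hd]
        exact Nat.mul_lt_mul_of_pos_left (by omega) (by omega)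
      have h := hL ((p - 1) * (a + 1)) hlt.le
      rw [apply_dicksonL_mul_X_pow, lineCoeff, if_pos ⟨dvd_mul_right _ _, Nat.mul_pos (by omega)
        (by omega), hlt⟩, mul_one] at h
      have h1 := ih (by omega)
      have he : (p - 1) * (a + 1 + 1) + 1 = (p - 1) * (a + 1) + p := by
        rw [mul_add (p - 1) (a + 1)]; omega
      rw [he, Nat.cast_succ]
      refine (dvd_add h h1).trans (dvd_of_eq ?_)
      ring
  have h1 := key m le_rfl
  rw [← hd] at h1
  have h2 := hL d le_rfl
  rw [apply_dicksonL_mul_X_pow, lineCoeff, if_neg (by simp), mul_zero, sub_zero] at h2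
  have h3 := dvd_apply_X_pow_of_high hp hφ (by omega) (l := d + p) (by omega) (by omega)
  have h4 := (dvd_iff_dvd_of_dvd_sub h2).1 h3
  exact (dvd_iff_dvd_of_dvd_sub h1).1 h4

end Invariant

/-! ### The span of the residue classes and the classification modulo `p` -/

/-- The functionals on binary forms of degree `d` spanned by the classes of
`1 / (L ^ (p ^ k i) Q ^ (p ^ k j))`, with `i` and `j` positive, modulo `p ^ (k + 1)`. -/
def residueSpan (p k d : ℕ) : Submodule ℤ (ℤ[X] →ₗ[ℤ] ℤ) :=
  Submodule.span ℤ {φ | ∃ i j : ℕ, 1 ≤ i ∧ 1 ≤ j ∧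
    d + 2 = p ^ k * (i * (p + 1) + j * (p * (p - 1))) ∧
    φ = dicksonResidue p (k + 1) (p ^ k * i) (p ^ k * j)}

section ResidueSpan

variable {p : ℕ}

theorem residueSpan_le (hp : p.Prime) (hp2 : Odd p) (k d : ℕ) :
    residueSpan p k d ≤ invariantFunctionals ((p ^ (k + 1) : ℕ) : ℤ) d := by
  rw [residueSpan, Submodule.span_le]
  rintro _ ⟨i, j, hi, hj, hd, rfl⟩
  exact dicksonResidue_mem hp hp2 k hi hj hd

/-- Residue classes can be divided by powers of `L`: raise the exponent of `L` in each denominator.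
-/
theorem exists_residueSpan_dvd_dicksonL_mul_sub (hp : p.Prime) {k d s : ℕ} {ψ : ℤ[X] →ₗ[ℤ] ℤ}
    (hψ : ψ ∈ residueSpan p k d) : ∃ ψ' ∈ residueSpan p k (p ^ k * (s * (p + 1)) + d),
      ∀ f : ℤ[X], f.natDegree ≤ d →
        ((p ^ (k + 1) : ℕ) : ℤ) ∣ ψ' (dicksonL p ^ (p ^ k * s) * f) - ψ f := by
  have hq : 1 ≤ p ^ k := Nat.one_le_pow _ _ hp.pos
  refine Submodule.span_induction ?_ ?_ ?_ ?_ hψ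
  · rintro _ ⟨i, j, hi, hj, hd, rfl⟩
    refine ⟨dicksonResidue p (k + 1) (p ^ k * (i + s)) (p ^ k * j),
      Submodule.subset_span ⟨i + s, j, by omega, hj, ?_, rfl⟩, fun f hf => ?_⟩
    · rw [add_assoc, hd]
      ring
    · have h1 := isDicksonResidue hp (k + 1) (Nat.mul_le_mul hq hi) (Nat.mul_le_mul hq hj)
      have h2 := isDicksonResidue hp (k + 1) (Nat.mul_le_mul hq (by omega : 1 ≤ i + s))
        (Nat.mul_le_mul hq hj)
      rw [mul_add] at h2 ⊢
      refine h1.dvd_mul_dicksonL_sub h2 dvd_rfl dvd_rfl ?_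
      have : p ^ k * i * (p + 1) + p ^ k * j * (p * (p - 1)) = d + 2 := by rw [hd]; ring
      omega
  · exact ⟨0, zero_mem _, by simp⟩
  · rintro ψ₁ ψ₂ _ _ ⟨χ₁, hχ₁, h₁⟩ ⟨χ₂, hχ₂, h₂⟩
    refine ⟨χ₁ + χ₂, add_mem hχ₁ hχ₂, fun f hf => ?_⟩
    rw [LinearMap.add_apply, LinearMap.add_apply, add_sub_add_comm]
    exact dvd_add (h₁ f hf) (h₂ f hf)
  · rintro c ψ₁ _ ⟨χ₁, hχ₁, h₁⟩
    refine ⟨c • χ₁, Submodule.smul_mem _ c hχ₁, fun f hf => ?_⟩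
    rw [LinearMap.smul_apply, LinearMap.smul_apply, ← smul_sub]
    exact (h₁ f hf).mul_left c

theorem natDegree_dicksonL_pow_mul_X_pow_add_two_le (hp : p.Prime) {i j : ℕ} (hi : 1 ≤ i)
    (hj : 1 ≤ j) : (dicksonL p ^ i * X ^ (j * (p * (p - 1)) - 1)).natDegree + 2 ≤
      i * (p + 1) + j * (p * (p - 1)) := by
  have h1 : (dicksonL p ^ i * X ^ (j * (p * (p - 1)) - 1)).natDegree ≤
      i * p + (j * (p * (p - 1)) - 1) :=
    natDegree_mul_le_of_le (natDegree_pow_le_of_le i (natDegree_dicksonL hp.one_lt).le)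
      (natDegree_X_pow_le _)
  have h2 : 1 ≤ j * (p * (p - 1)) := by
    have := hp.two_le
    exact Nat.mul_le_mul hj (Nat.mul_le_mul hp.one_le (by omega : 1 ≤ p - 1))
  have h3 : i * (p + 1) = i * p + i := by ring
  omega

/-- Classification of the functionals on binary forms of degree `d ≥ 1` that are invariant modulo
`p`: up to multiples of the functional with coefficients `lineCoeff`, they are combinations of the
classes of `1 / (L ^ i Q ^ j)`. -/
theorem exists_residueSpan_add_lineCoeff (hp : p.Prime) (hp3 : 3 < p) {d : ℕ} (hd : 1 ≤ d)
    {φ : ℤ[X] →ₗ[ℤ] ℤ} (hφ : φ ∈ invariantFunctionals p d) :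
    ∃ ψ ∈ residueSpan p 0 d, ∃ ε : ℤ,
      (∀ k ≤ d, (p : ℤ) ∣ φ (X ^ k) - ψ (X ^ k) - ε * lineCoeff p d k) ∧
      (ε = 0 ∨ ∃ m, 1 ≤ m ∧ d = (p - 1) * (m + 1) ∧ ¬ p ∣ m) := by
  have hp' : Prime (p : ℤ) := Nat.prime_iff_prime_int.1 hp
  have hp2 : Odd p := hp.odd_of_ne_two (by omega)
  induction d using Nat.strong_induction_on generalizing φ with
  | _ d ih =>
  by_cases hsmall : d + 3 ≤ 2 * p
  · refine ⟨0, zero_mem _, 0, fun k hk => ?_, Or.inl rfl⟩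
    simpa using dvd_apply_X_pow_of_degree_lt hp hφ hd hsmall hk
  obtain ⟨e, he⟩ : ∃ e, d = p + 1 + e := ⟨d - (p + 1), by omega⟩
  -- The transpose of multiplication by `L` lowers the degree by `p + 1`. The residue part found
  -- there by induction is lifted back through `L` and subtracted from `φ`.
  have hLφ : φ ∘ₗ LinearMap.mulLeft ℤ (dicksonL p) ∈ invariantFunctionals p e :=
    mulLeft_mem_invariantFunctionals (natDegree_dicksonL_le p) (C_dvd_taylor_dicksonL hp)
      (signedReflect_dicksonL hp2) (he ▸ hφ)
  obtain ⟨ψ, hψ, ε, h1, h2⟩ := ih e (by omega) (by omega) hLφ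
  obtain ⟨ψ', hψ', h3⟩ := exists_residueSpan_dvd_dicksonL_mul_sub hp (s := 1) hψ
  have hed : p ^ 0 * (1 * (p + 1)) + e = d := by rw [he]; ring
  rw [hed] at hψ'
  simp only [pow_zero, zero_add, pow_one, mul_one] at h3
  have hψ'inv := residueSpan_le hp hp2 0 d hψ'
  rw [zero_add, pow_one] at hψ'inv
  have hφ' : φ - ψ' ∈ invariantFunctionals p d := sub_mem hφ hψ'inv
  have h4 : ∀ k ≤ e, (p : ℤ) ∣ (φ - ψ') (dicksonL p * X ^ k) - ε * lineCoeff p e k := by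
    intro k hk
    have h5 := h1 k hk
    have h6 := h3 (X ^ k) (by simpa using hk)
    rw [LinearMap.comp_apply, LinearMap.mulLeft_apply] at h5
    rw [LinearMap.sub_apply]
    refine (dvd_sub h5 h6).trans (dvd_of_eq ?_)
    ring
  -- An exceptional part in degree `e` would have `p ∤ m`, and the telescoping obstruction forbids
  -- this. So the corrected functional annihilates the multiples of `L` modulo `p`.
  have hε : (p : ℤ) ∣ ε := by
    rcases h2 with h | ⟨m, hm, hem, hpm⟩
    · rw [h]
      exact dvd_zero _
    · exact (hp'.dvd_mul.1 (dvd_mul_of_dicksonL_mul_eq_lineCoeff hp (by omega) hem (he ▸ hφ') ε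
        h4)).resolve_right fun h => hpm (Int.natCast_dvd_natCast.1 h)
  rcases eq_lineCoeff_of_dvd_apply_dicksonL_mul hp (by omega) hφ' hd (fun k hk => by
      have h5 := h4 k (by omega)
      exact (dvd_iff_dvd_of_dvd_sub h5).2 (hε.mul_right _)) with
    h5 | ⟨m, hm, hdm, ε', h5⟩
  · exact ⟨ψ', hψ', 0, fun k hk => by simpa using h5 k hk, Or.inl rfl⟩
  by_cases hpm : p ∣ m
  swap
  · exact ⟨ψ', hψ', ε', h5, Or.inr ⟨m, hm, hdm, hpm⟩⟩
  obtain ⟨t, rfl⟩ := hpm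
  have ht : 1 ≤ t := Nat.pos_of_ne_zero (by rintro rfl; simp at hm)
  have hdt : d + 2 = p ^ 0 * (1 * (p + 1) + t * (p * (p - 1))) := by
    obtain ⟨r, rfl⟩ : ∃ r, p = r + 1 := ⟨p - 1, by omega⟩
    rw [hdm, Nat.add_sub_cancel]
    ring
  -- When `m = p t`, the class `1 / (L Q^t)` lies in this degree and is annihilated by `L`. Being
  -- nonzero modulo `p`, it is a unit multiple of the line functional, which is therefore not
  -- exceptional.
  set χ := dicksonResidue p (0 + 1) (p ^ 0 * 1) (p ^ 0 * t) with hχ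
  have hχmem : χ ∈ residueSpan p 0 d := Submodule.subset_span ⟨1, t, le_rfl, ht, hdt, rfl⟩
  have hχinv := residueSpan_le hp hp2 0 d hχmem
  have hres := isDicksonResidue hp (0 + 1) (i := p ^ 0 * 1) (j := p ^ 0 * t) (by simp)
    (by simpa using ht)
  rw [← hχ] at hres
  simp only [zero_add, pow_one, pow_zero, one_mul] at hχinv hres hdt
  rcases eq_lineCoeff_of_dvd_apply_dicksonL_mul hp (by omega) hχinv hd (fun k hk => by
      have h := hres.dvd_apply_dicksonL_pow_mul (s := 1) (f := X ^ k) le_rfl (by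
        rw [natDegree_X_pow]; omega)
      simpa using h) with h6 | ⟨_, _, _, ε'', h6⟩
  · exfalso
    have h7 : (p : ℤ) ∣ χ (dicksonL p ^ 1 * X ^ (t * (p * (p - 1)) - 1)) := by
      refine dvd_apply_of_dvd_X_pow h6 ?_
      have := natDegree_dicksonL_pow_mul_X_pow_add_two_le hp (i := 1) le_rfl ht
      omega
    exact hp'.not_dvd_one ((dvd_sub_right h7).1 hres.normalized)
  have hε'' : ¬ (p : ℤ) ∣ ε'' := by
    intro h
    have h7 : (p : ℤ) ∣ χ (dicksonL p ^ 1 * X ^ (t * (p * (p - 1)) - 1)) := by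
      refine dvd_apply_of_dvd_X_pow (fun k hk => (dvd_iff_dvd_of_dvd_sub (h6 k hk)).2
        (h.mul_right _)) ?_
      have := natDegree_dicksonL_pow_mul_X_pow_add_two_le hp (i := 1) le_rfl ht
      omega
    exact hp'.not_dvd_one ((dvd_sub_right h7).1 hres.normalized)
  -- Modulo `p`, `v` inverts `ε''`, so `ε' v χ` absorbs the line functional.
  obtain ⟨u, v, huv⟩ := ((Prime.coprime_iff_not_dvd hp').2 hε'')
  refine ⟨ψ' + (ε' * v) • χ, add_mem hψ' (Submodule.smul_mem _ _ hχmem), 0, fun k hk => ?_,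
    Or.inl rfl⟩
  have h7 := h5 k hk
  have h8 := (h6 k hk).mul_left (ε' * v)
  rw [LinearMap.sub_apply] at h7
  rw [LinearMap.add_apply, LinearMap.smul_apply, smul_eq_mul, zero_mul, sub_zero]
  refine (dvd_add (dvd_sub h7 h8) (Dvd.intro (ε' * u * lineCoeff p d k) rfl)).trans
    (dvd_of_eq ?_)
  linear_combination (ε' * lineCoeff p d k) * huv

end ResidueSpan

/-! ### Frobenius and Cartier operations on functionals -/

/-- The functional with prescribed values on the powers of `X`. -/
def functionalOfSeq (c : ℕ → ℤ) : ℤ[X] →ₗ[ℤ] ℤ := (Polynomial.basisMonomials ℤ).constr ℤ c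

theorem functionalOfSeq_X_pow (c : ℕ → ℤ) (k : ℕ) : functionalOfSeq c (X ^ k) = c k := by
  have h := (Polynomial.basisMonomials ℤ).constr_basis ℤ c k
  rw [coe_basisMonomials] at h
  beta_reduce at h
  rwa [monomial_one_right_eq_X_pow] at h

/-- The action of Frobenius on local cohomology, `X ^ (-k) Y ^ (-l) ↦ X ^ (-p k) Y ^ (-p l)`. -/
def frobeniusFunctional (p : ℕ) (φ : ℤ[X] →ₗ[ℤ] ℤ) : ℤ[X] →ₗ[ℤ] ℤ :=
  functionalOfSeq fun k => if p ∣ k + 1 then φ (X ^ ((k + 1) / p - 1)) else 0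

/-- The operation `f ↦ coefficients of f at exponents p (k + 1) - 1` on functionals, a left inverse
of Frobenius. -/
def cartierFunctional (p : ℕ) (φ : ℤ[X] →ₗ[ℤ] ℤ) : ℤ[X] →ₗ[ℤ] ℤ :=
  functionalOfSeq fun l => φ (X ^ (p * (l + 1) - 1))

section Frobenius

variable {p : ℕ}

/-- The projection formula for Frobenius. The shift by one in the exponents is the shift between a
monomial and its dual class in local cohomology. -/
theorem frobeniusFunctional_expand_mul (hp : 1 ≤ p) (φ : ℤ[X] →ₗ[ℤ] ℤ) (g : ℤ[X]) (k : ℕ) :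
    frobeniusFunctional p φ (expand ℤ p g * X ^ k) =
      if p ∣ k + 1 then φ (g * X ^ ((k + 1) / p - 1)) else 0 := by
  induction g using Polynomial.induction_on' with
  | add f g hf hg =>
    rw [map_add, add_mul, map_add, hf, hg, add_mul, map_add]
    split_ifs <;> simp
  | monomial m c =>
    have hiff : p ∣ p * m + k + 1 ↔ p ∣ k + 1 := by
      rw [add_assoc, Nat.dvd_add_right (dvd_mul_right _ _)]
    rw [← C_mul_X_pow_eq_monomial, map_mul (expand ℤ p), expand_C, map_pow, expand_X, ← pow_mul,
      mul_assoc, ← pow_add, mul_assoc, ← smul_eq_C_mul, map_smul, ← smul_eq_C_mul, map_smul,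
      ← pow_add, frobeniusFunctional, functionalOfSeq_X_pow]
    by_cases h : p ∣ k + 1
    · rw [if_pos h, if_pos (hiff.2 h), add_assoc]
      obtain ⟨t, ht⟩ := h
      have ht0 : t ≠ 0 := by rintro rfl; omega
      rw [ht, ← mul_add, Nat.mul_div_cancel_left _ hp, Nat.mul_div_cancel_left _ hp,
        Nat.add_sub_assoc (by omega)]
    · rw [if_neg h, if_neg (fun h' => h (hiff.1 h')), smul_zero]

theorem C_dvd_pow_mul_sub_expand (hp : p.Prime) (g : ℤ[X]) (i : ℕ) :
    C (p : ℤ) ∣ g ^ (p * i) - expand ℤ p (g ^ i) := by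
  have : Fact p.Prime := ⟨hp⟩
  rw [C_dvd_sub_iff_map_eq, map_expand, ZMod.expand_card, Polynomial.map_pow, Polynomial.map_pow,
    ← pow_mul, mul_comm]

/-- Modulo `p` one has `L^(p i) = L^i(X^p)`, and likewise for `Q`. By the projection formula the
Frobenius image annihilates the multiples of `L^(p i)` and `Q^(p j)`, and uniqueness applies. That
the scalar is nonzero is not needed. -/
theorem IsDicksonResidue.dvd_frobeniusFunctional_sub (hp : p.Prime) {n n' : ℤ} {i j : ℕ}
    {φ φ' : ℤ[X] →ₗ[ℤ] ℤ} (hφ : IsDicksonResidue p n i j φ)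
    (hφ' : IsDicksonResidue p n' (p * i) (p * j) φ') (hn : (p : ℤ) ∣ n) (hn' : (p : ℤ) ∣ n') :
    ∃ c : ℤ, ∀ f : ℤ[X], f.natDegree + 2 ≤ p * (i * (p + 1) + j * (p * (p - 1))) →
      (p : ℤ) ∣ frobeniusFunctional p φ f - c * φ' f := by
  have hred : ∀ (g f : ℤ[X]) (s : ℕ), (p : ℤ) ∣ frobeniusFunctional p φ (g ^ (p * s) * f) -
      frobeniusFunctional p φ (expand ℤ p (g ^ s) * f) := by
    intro g f s
    refine dvd_apply_sub _ ?_
    rw [← sub_mul]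
    exact (C_dvd_pow_mul_sub_expand hp g s).mul_right _
  refine ⟨_, fun f hf => hφ'.unique p hn' (frobeniusFunctional p φ) (fun g hg => ?_)
    (fun g hg => ?_) f (hf.trans (le_of_eq (by ring)))⟩
  · rw [dvd_iff_dvd_of_dvd_sub (hred _ _ _)]
    refine dvd_apply_of_dvd_X_pow (d := g.natDegree)
      (φ := frobeniusFunctional p φ ∘ₗ LinearMap.mulLeft ℤ (expand ℤ p (dicksonL p ^ i)))
      (fun k hk => ?_) le_rfl
    rw [LinearMap.comp_apply, LinearMap.mulLeft_apply, frobeniusFunctional_expand_mul hp.one_le]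
    split_ifs with h
    · obtain ⟨t, ht⟩ := h
      refine hn.trans (hφ.dvd_dicksonL _ ?_)
      rw [natDegree_X_pow, ht, Nat.mul_div_cancel_left _ hp.pos]
      have h1 : p * t < p * (j * (p * (p - 1))) := by rw [← mul_assoc p j]; omega
      have h2 := lt_of_mul_lt_mul_left' h1
      have ht0 : t ≠ 0 := by rintro rfl; omega
      omega
    · exact dvd_zero _
  · rw [dvd_iff_dvd_of_dvd_sub (hred _ _ _)]
    refine dvd_apply_of_dvd_X_pow (d := g.natDegree)
      (φ := frobeniusFunctional p φ ∘ₗ LinearMap.mulLeft ℤ (expand ℤ p (dicksonQ p ^ j)))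
      (fun k hk => ?_) le_rfl
    rw [LinearMap.comp_apply, LinearMap.mulLeft_apply, frobeniusFunctional_expand_mul hp.one_le]
    split_ifs with h
    · exact hn.trans (hφ.dvd_dicksonQ _)
    · exact dvd_zero _

theorem frobeniusFunctional_X_pow (p : ℕ) (φ : ℤ[X] →ₗ[ℤ] ℤ) (k : ℕ) :
    frobeniusFunctional p φ (X ^ k) = if p ∣ k + 1 then φ (X ^ ((k + 1) / p - 1)) else 0 :=
  functionalOfSeq_X_pow _ _

theorem exists_residueSpan_frobenius (hp : p.Prime) {k d e : ℕ} (hd : d + 2 = p * (e + 2))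
    {ψ : ℤ[X] →ₗ[ℤ] ℤ} (hψ : ψ ∈ residueSpan p k e) :
    ∃ ψ' ∈ residueSpan p (k + 1) d, ∀ l ≤ d,
      (p : ℤ) ∣ frobeniusFunctional p ψ (X ^ l) - ψ' (X ^ l) := by
  have hq : ∀ k, 1 ≤ p ^ k := fun k => Nat.one_le_pow _ _ hp.pos
  have hpn : ∀ k, (p : ℤ) ∣ ((p ^ (k + 1) : ℕ) : ℤ) := fun k =>
    Int.natCast_dvd_natCast.2 (dvd_pow_self p (by omega))
  refine Submodule.span_induction ?_ ?_ ?_ ?_ hψ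
  · rintro _ ⟨i, j, hi, hj, he, rfl⟩
    have h1 := isDicksonResidue hp (k + 1) (Nat.mul_le_mul (hq k) hi) (Nat.mul_le_mul (hq k) hj)
    have h2 := isDicksonResidue hp (k + 1 + 1) (Nat.mul_le_mul (hq (k + 1)) hi)
      (Nat.mul_le_mul (hq (k + 1)) hj)
    have h3 : ∀ i, p ^ (k + 1) * i = p * (p ^ k * i) := fun i => by ring
    rw [h3, h3] at h2
    obtain ⟨c, hc⟩ := h1.dvd_frobeniusFunctional_sub hp h2 (hpn k) (hpn (k + 1))
    refine ⟨c • _, Submodule.smul_mem _ c (Submodule.subset_span ⟨i, j, hi, hj, ?_, rfl⟩),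
      fun l hl => ?_⟩
    · rw [hd, he]; ring
    · rw [LinearMap.smul_apply, h3, h3]
      refine hc _ ?_
      rw [natDegree_X_pow]
      have : p * (p ^ k * i * (p + 1) + p ^ k * j * (p * (p - 1))) = d + 2 := by
        rw [hd, he]; ring
      omega
  · exact ⟨0, zero_mem _, by simp [frobeniusFunctional_X_pow]⟩
  · rintro ψ₁ ψ₂ _ _ ⟨χ₁, hχ₁, h₁⟩ ⟨χ₂, hχ₂, h₂⟩
    refine ⟨χ₁ + χ₂, add_mem hχ₁ hχ₂, fun l hl => ?_⟩
    have h3 := dvd_add (h₁ l hl) (h₂ l hl)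
    rw [frobeniusFunctional_X_pow, frobeniusFunctional_X_pow] at h3
    rw [frobeniusFunctional_X_pow, LinearMap.add_apply, LinearMap.add_apply]
    split_ifs at h3 ⊢ <;> exact h3.trans (dvd_of_eq (by ring))
  · rintro c ψ₁ _ ⟨χ₁, hχ₁, h₁⟩
    refine ⟨c • χ₁, Submodule.smul_mem _ c hχ₁, fun l hl => ?_⟩
    have h3 := (h₁ l hl).mul_left c
    rw [frobeniusFunctional_X_pow] at h3
    rw [frobeniusFunctional_X_pow, LinearMap.smul_apply, LinearMap.smul_apply, smul_eq_mul,
      smul_eq_mul]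
    split_ifs at h3 ⊢ <;> exact h3.trans (dvd_of_eq (by ring))

end Frobenius

/-! ### Descent from modulus `p^(δ+1)` to modulus `p^δ` -/

section Descent

variable {p d : ℕ} {φ : ℤ[X] →ₗ[ℤ] ℤ}

theorem dvd_apply_taylor_natCast_sub {n : ℤ} (hφ : φ ∈ invariantFunctionals n d) (s : ℕ)
    {f : ℤ[X]} (hf : f.natDegree ≤ d) : n ∣ φ (taylor (s : ℤ) f) - φ f := by
  induction s with
  | zero => simp
  | succ s ih =>
    have h := hφ.1 (taylor (s : ℤ) f) (by rwa [natDegree_taylor])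
    rw [taylor_taylor] at h
    have h2 := dvd_add h ih
    rw [sub_add_sub_cancel] at h2
    rwa [Nat.cast_succ, add_comm]

/-- This says that `p^l / l` is still divisible by `p^2` for `l ≥ 2`, which controls the higher
terms of a Taylor expansion with step `p`. -/
theorem add_two_le_of_pow_dvd {p v l : ℕ} (hp : 3 ≤ p) (hl : 2 ≤ l) (h : p ^ v ∣ l) :
    v + 2 ≤ l := by
  rcases Nat.eq_zero_or_pos v with rfl | hv
  · omega
  · have h1 := Nat.le_of_dvd (by omega) h
    have h2 : 3 ^ v ≤ p ^ v := Nat.pow_le_pow_left hp v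
    have h3 : v + 2 ≤ 3 ^ v := by
      clear h1 h2 h
      induction v, hv using Nat.le_induction with
      | base => norm_num
      | succ v _ ih => rw [pow_succ]; omega
    omega

/-- Expand the invariance under translation by `p` at `X^(k+1)`: the linear term is `p (k + 1)
φ(X^k)`. The term with `p^l`, `l ≥ 2`, equals `p^l / l` times a multiple of some `(m + 1) φ(X^m)`,
so induction on the exponent shows that it is negligible. -/
theorem pow_dvd_succ_mul_apply (hp : p.Prime) (hp3 : 3 ≤ p) {δ : ℕ}
    (hφ : φ ∈ invariantFunctionals ((p ^ (δ + 1) : ℕ) : ℤ) d) {k : ℕ} (hk : k < d) :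
    (p : ℤ) ^ δ ∣ ((k + 1 : ℕ) : ℤ) * φ (X ^ k) := by
  have hp' : Prime (p : ℤ) := Nat.prime_iff_prime_int.1 hp
  suffices H : ∀ w ≤ δ, ∀ k < d, (p : ℤ) ^ w ∣ ((k + 1 : ℕ) : ℤ) * φ (X ^ k) from H δ le_rfl k hk
  intro w
  induction w with
  | zero => intro _ k _; simp
  | succ w ih =>
    intro hw k hk
    have ih := ih (by omega)
    have h1 := dvd_apply_taylor_natCast_sub hφ p (f := X ^ (k + 1)) (by
      rw [natDegree_X_pow]; omega)
    have h2 : (p : ℤ) ^ (w + 2) ∣ ((p ^ (δ + 1) : ℕ) : ℤ) := by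
      rw [Nat.cast_pow]
      exact pow_dvd_pow _ (by omega)
    have h1 := h2.trans h1
    have hexp : φ (taylor (p : ℤ) (X ^ (k + 1))) = ∑ m ∈ Finset.range (k + 2),
        (p : ℤ) ^ (k + 1 - m) * (((k + 1).choose m : ℤ) * φ (X ^ m)) := by
      rw [taylor_X_pow, add_pow, map_sum]
      refine Finset.sum_congr rfl fun m _ => ?_
      have : (X ^ m * C (p : ℤ) ^ (k + 1 - m) * ((k + 1).choose m : ℤ[X])) =
          ((p : ℤ) ^ (k + 1 - m) * ((k + 1).choose m : ℤ)) • X ^ m := by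
        rw [smul_eq_C_mul, map_mul, map_pow, ← C_eq_natCast]
        ring
      rw [this, map_smul, smul_eq_mul, mul_assoc]
    rw [hexp, Finset.sum_range_succ, Finset.sum_range_succ] at h1
    simp only [Nat.choose_self, Nat.sub_self, pow_zero, one_mul, Nat.cast_one,
      add_sub_cancel_right] at h1
    have h3 : (p : ℤ) ^ (w + 2) ∣ ∑ m ∈ Finset.range k,
        (p : ℤ) ^ (k + 1 - m) * (((k + 1).choose m : ℤ) * φ (X ^ m)) := by
      refine Finset.dvd_sum fun m hm => ?_
      rw [Finset.mem_range] at hm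
      obtain ⟨l, hl⟩ : ∃ l, k + 1 - m = l := ⟨_, rfl⟩
      have hl2 : 2 ≤ l := by omega
      rw [hl]
      set Y := ((k + 1).choose m : ℤ) * φ (X ^ m) with hY
      have h4 : (p : ℤ) ^ w ∣ (l : ℤ) * Y := by
        -- The identity `l C(k+1, m) = (m + 1) C(k+1, m+1)`, with `l = k + 1 - m`, produces the
        -- factor `m + 1` that the induction hypothesis needs.
        have h5 := Nat.choose_succ_right_eq (k + 1) m
        rw [hl] at h5
        have h6 : (l : ℤ) * Y = ((k + 1).choose (m + 1) : ℤ) * (((m + 1 : ℕ) : ℤ) * φ (X ^ m)) := by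
          have h7 : (((k + 1).choose (m + 1) : ℤ)) * ((m + 1 : ℕ) : ℤ) =
              ((k + 1).choose m : ℤ) * (l : ℤ) := by exact_mod_cast h5
          rw [hY]
          linear_combination -(φ (X ^ m)) * h7
        rw [h6]
        exact (ih m (by omega)).mul_left _
      obtain ⟨v, u, hu, hlu⟩ := Nat.exists_eq_pow_mul_and_not_dvd (n := l) (by omega) p hp.ne_one
      have h5 : (p : ℤ) ^ w ∣ (p : ℤ) ^ v * Y := by
        refine IsCoprime.dvd_of_dvd_mul_left (x := (p : ℤ) ^ w) (y := (u : ℤ)) ?_ ?_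
        · exact ((Prime.coprime_iff_not_dvd hp').2
            (fun h => hu (Int.natCast_dvd_natCast.1 h))).pow_left
        · refine h4.trans (dvd_of_eq ?_)
          rw [hlu]
          push_cast
          ring
      have h6 := add_two_le_of_pow_dvd (v := v) hp3 hl2 ⟨u, hlu⟩
      have h7 : (p : ℤ) ^ l * Y = (p : ℤ) ^ (l - v) * ((p : ℤ) ^ v * Y) := by
        rw [← mul_assoc ((p : ℤ) ^ (l - v)), ← pow_add, Nat.sub_add_cancel (by omega)]
      rw [h7]
      exact (pow_dvd_pow _ (by omega : w + 2 ≤ l - v + w)).trans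
        ((pow_add (p : ℤ) (l - v) w).symm ▸ mul_dvd_mul_left _ h5)
    have h4 := (dvd_add_right h3).1 h1
    rw [Nat.choose_succ_self_right, Nat.add_sub_cancel_left, pow_one, pow_succ' (p : ℤ) (w + 1)]
      at h4
    exact (mul_dvd_mul_iff_left hp'.ne_zero).1 h4

/-- Let `N = j + 1 = p^v u` with `p ∤ u`. Then `(X + 1)^(p N) ≡ (X^p + 1)^N` modulo `p^(v+1)`, and
absorption, `N C(N-1, M-1) = M C(N, M)`, trades `p^v` for the factor `M = l + 1`. This precision is
what the divisibility of `(k + 1) φ(X^k)` can use. -/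
theorem exists_dvd_choose_sub_choose (hp : p.Prime) (j l : ℕ) : ∃ u : ℤ, ¬ (p : ℤ) ∣ u ∧
    ((p * (l + 1) : ℕ) : ℤ) ∣
      u * (((p * (j + 1) - 1).choose (p * (l + 1) - 1) : ℤ) - (j.choose l : ℤ)) := by
  have hp' : Prime (p : ℤ) := Nat.prime_iff_prime_int.1 hp
  have : Fact p.Prime := ⟨hp⟩
  obtain ⟨v, u, hu, hN⟩ := Nat.exists_eq_pow_mul_and_not_dvd (n := j + 1) (by omega) p hp.ne_one
  refine ⟨u, fun h => hu (Int.natCast_dvd_natCast.1 h), ?_⟩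
  have h1 : (p : ℤ[X]) ∣ (X + 1) ^ p - (X ^ p + 1) := by
    have : C (p : ℤ) ∣ (X + 1 : ℤ[X]) ^ p - (X ^ p + 1) := by
      rw [C_dvd_sub_iff_map_eq]
      simp [add_pow_char]
    simpa using this
  have h2 : C ((p : ℤ) ^ (v + 1)) ∣ (X + 1 : ℤ[X]) ^ (p * (j + 1)) - (X ^ p + 1) ^ (j + 1) := by
    have h3 := dvd_sub_pow_of_dvd_sub h1 v
    rw [pow_mul, hN, pow_mul, pow_mul (X ^ p + 1 : ℤ[X])]
    refine dvd_trans ?_ (sub_dvd_pow_sub_pow _ _ u)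
    simpa using h3
  have h3 : (p : ℤ) ^ (v + 1) ∣
      ((p * (j + 1)).choose (p * (l + 1)) : ℤ) - ((j + 1).choose (l + 1) : ℤ) := by
    rw [C_dvd_iff_dvd_coeff] at h2
    have h4 := h2 (p * (l + 1))
    have h5 : (X ^ p + 1 : ℤ[X]) ^ (j + 1) = expand ℤ p ((X + 1) ^ (j + 1)) := by
      rw [map_pow, map_add, expand_X, map_one]
    rwa [coeff_sub, coeff_X_add_one_pow, h5, coeff_expand_mul' hp.pos, coeff_X_add_one_pow] at h4
  obtain ⟨z, hz⟩ := h3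
  have h4 := Nat.add_one_mul_choose_eq j l
  have h5 := Nat.add_one_mul_choose_eq (p * (j + 1) - 1) (p * (l + 1) - 1)
  have hpj : p * (j + 1) - 1 + 1 = p * (j + 1) :=
    Nat.sub_add_cancel (Nat.mul_pos hp.pos (by omega))
  have hpl : p * (l + 1) - 1 + 1 = p * (l + 1) :=
    Nat.sub_add_cancel (Nat.mul_pos hp.pos (by omega))
  simp only [hpj, hpl] at h5
  have h4' : ((j + 1 : ℕ) : ℤ) * (j.choose l : ℤ) =
    ((j + 1).choose (l + 1) : ℤ) * ((l + 1 : ℕ) : ℤ) := by exact_mod_cast h4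
  have h5' : (p : ℤ) * (((j + 1 : ℕ) : ℤ) * ((p * (j + 1) - 1).choose (p * (l + 1) - 1) : ℤ)) =
      (p : ℤ) * (((p * (j + 1)).choose (p * (l + 1)) : ℤ) * ((l + 1 : ℕ) : ℤ)) := by
    have : (p * (j + 1)) * ((p * (j + 1) - 1).choose (p * (l + 1) - 1)) =
      ((p * (j + 1)).choose (p * (l + 1))) * (p * (l + 1)) := h5
    have h : (((p * (j + 1)) * ((p * (j + 1) - 1).choose (p * (l + 1) - 1)) : ℕ) : ℤ) =
      ((((p * (j + 1)).choose (p * (l + 1))) * (p * (l + 1)) : ℕ) : ℤ) := by rw [this]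
    push_cast at h ⊢
    linear_combination h
  have h6 := mul_left_cancel₀ hp'.ne_zero h5'
  have hN' : ((j + 1 : ℕ) : ℤ) = (p : ℤ) ^ v * u := by rw [hN]; push_cast; ring
  rw [hN'] at h4' h6
  refine ⟨z, mul_left_cancel₀ (pow_ne_zero v hp'.ne_zero) ?_⟩
  push_cast at h4' h6 hz ⊢
  rw [pow_succ] at hz
  linear_combination h6 - h4' + ((l : ℤ) + 1) * hz

/-- A value that is nonzero modulo `p` needs `p ∣ k + 1`, and by the reflection symmetry also `p ∣ d
- k + 1`; the sum of the two is `d + 2`. -/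
theorem dvd_apply_X_pow_or_exists_degree (hp : p.Prime) (hp3 : 3 ≤ p) {δ : ℕ} (hδ : 1 ≤ δ)
    (hd : 1 ≤ d) (hφ : φ ∈ invariantFunctionals ((p ^ (δ + 1) : ℕ) : ℤ) d) :
    (∀ k ≤ d, (p : ℤ) ∣ φ (X ^ k)) ∨ ∃ e, d + 2 = p * (e + 2) := by
  have hp' : Prime (p : ℤ) := Nat.prime_iff_prime_int.1 hp
  have hpn : (p : ℤ) ∣ ((p ^ (δ + 1) : ℕ) : ℤ) :=
    Int.natCast_dvd_natCast.2 (dvd_pow_self p (by omega))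
  have hk1 : ∀ k < d, ¬ (p : ℤ) ∣ φ (X ^ k) → p ∣ k + 1 := by
    intro k hk h
    have h1 := (dvd_pow_self (p : ℤ) (by omega : δ ≠ 0)).trans
      (pow_dvd_succ_mul_apply hp hp3 hφ hk)
    exact Int.natCast_dvd_natCast.1 ((hp'.dvd_mul.1 h1).resolve_right h)
  by_cases hz : ∀ k ≤ d, (p : ℤ) ∣ φ (X ^ k)
  · exact Or.inl hz
  push Not at hz
  obtain ⟨k, hk, hkz⟩ := hz
  right
  have hk0 : k ≠ 0 := by
    rintro rfl
    exact hkz (hpn.trans (dvd_apply_one hφ hd))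
  have hkd : k ≠ d := by
    rintro rfl
    exact hkz (hpn.trans (dvd_apply_X_pow_top hφ hd))
  obtain ⟨x, hx⟩ := hk1 k (by omega) hkz
  obtain ⟨y, hy⟩ := hk1 (d - k) (by omega)
    (fun h => hkz ((dvd_apply_X_pow_symm_iff hφ hpn hk).2 h))
  have hx0 : x ≠ 0 := by rintro rfl; omega
  have hy0 : y ≠ 0 := by rintro rfl; omega
  refine ⟨x + y - 2, ?_⟩
  rw [Nat.sub_add_cancel (by omega), mul_add, ← hx, ← hy]
  omega

/-- In the translation congruence for `X^(p(j+1)-1)`, the terms with `p ∤ m + 1` vanish modulo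
`p^δ`. In the others the binomial coefficient may be replaced by `C(j, l)`, since the error is, up
to a unit, a multiple of `p (l + 1)`, which annihilates the value modulo `p^δ`. -/
theorem cartierFunctional_mem (hp : p.Prime) (hp3 : 3 ≤ p) {δ e : ℕ} (hd : d + 2 = p * (e + 2))
    (hφ : φ ∈ invariantFunctionals ((p ^ (δ + 1) : ℕ) : ℤ) d) :
    cartierFunctional p φ ∈ invariantFunctionals ((p ^ δ : ℕ) : ℤ) e := by
  have hp' : Prime (p : ℤ) := Nat.prime_iff_prime_int.1 hp
  have hp2 : Odd p := hp.odd_of_ne_two (by omega)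
  have hn : ((p ^ δ : ℕ) : ℤ) ∣ ((p ^ (δ + 1) : ℕ) : ℤ) :=
    Int.natCast_dvd_natCast.2 (pow_dvd_pow p (by omega))
  have hval : ∀ l, cartierFunctional p φ (X ^ l) = φ (X ^ (p * (l + 1) - 1)) :=
    fun l => functionalOfSeq_X_pow _ _
  have hle : ∀ l ≤ e, p * (l + 1) + p ≤ d + 2 := fun l hl => by
    rw [hd]
    calc p * (l + 1) + p = p * (l + 2) := by ring
      _ ≤ p * (e + 2) := Nat.mul_le_mul_left _ (by omega)
  rw [mem_invariantFunctionals_iff]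
  refine ⟨fun j hj => ?_, fun l hl => ?_⟩
  · have hJ := hle j hj
    have h1 := hn.trans (dvd_sum_choose_mul hφ (k := p * (j + 1) - 1) (by omega))
    rw [← Finset.sum_filter_add_sum_filter_not _ (fun L => p ∣ L + 1)] at h1
    have h2 : ((p ^ δ : ℕ) : ℤ) ∣ ∑ L ∈ (Finset.range (p * (j + 1) - 1)).filter
        (fun L => ¬ p ∣ L + 1), ((p * (j + 1) - 1).choose L : ℤ) * φ (X ^ L) := by
      refine Finset.dvd_sum fun L hL => ?_
      rw [Finset.mem_filter, Finset.mem_range] at hL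
      refine Dvd.dvd.mul_left ?_ _
      have h3 := pow_dvd_succ_mul_apply hp hp3 hφ (k := L) (by omega)
      rw [Nat.cast_pow]
      refine IsCoprime.dvd_of_dvd_mul_left ?_ h3
      exact ((Prime.coprime_iff_not_dvd hp').2
        (fun h => hL.2 (Int.natCast_dvd_natCast.1 h))).pow_left
    have h3 := (dvd_add_left h2).1 h1
    have h4 : ∑ L ∈ (Finset.range (p * (j + 1) - 1)).filter (fun L => p ∣ L + 1),
        ((p * (j + 1) - 1).choose L : ℤ) * φ (X ^ L) = ∑ l ∈ Finset.range j,
          ((p * (j + 1) - 1).choose (p * (l + 1) - 1) : ℤ) * φ (X ^ (p * (l + 1) - 1)) := by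
      symm
      refine Finset.sum_nbij (fun l => p * (l + 1) - 1) ?_ ?_ ?_ (fun _ _ => rfl)
      · intro l hl
        rw [Finset.mem_range] at hl
        have h5 : p * (l + 1) < p * (j + 1) := Nat.mul_lt_mul_of_pos_left (by omega) hp.pos
        have h6 : 0 < p * (l + 1) := Nat.mul_pos hp.pos (by omega)
        rw [Finset.mem_filter, Finset.mem_range, Nat.sub_add_cancel h6]
        exact ⟨by omega, dvd_mul_right _ _⟩
      · intro a _ b _ hab
        have h5 : 0 < p * (a + 1) := Nat.mul_pos hp.pos (by omega)
        have h6 : 0 < p * (b + 1) := Nat.mul_pos hp.pos (by omega)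
        have h7 : p * (a + 1) = p * (b + 1) := by
          simp only at hab
          omega
        have := Nat.eq_of_mul_eq_mul_left hp.pos h7
        omega
      · intro L hL
        rw [Finset.mem_coe, Finset.mem_filter, Finset.mem_range] at hL
        obtain ⟨hL, t, ht⟩ := hL
        have ht0 : t ≠ 0 := by rintro rfl; omega
        refine ⟨t - 1, ?_, ?_⟩
        · rw [Finset.mem_coe, Finset.mem_range]
          have : p * t < p * (j + 1) := by omega
          have := Nat.lt_of_mul_lt_mul_left this
          omega
        · simp only [Nat.sub_add_cancel (by omega : 1 ≤ t), ← ht, Nat.add_sub_cancel]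
    rw [h4] at h3
    rw [apply_X_add_one_pow, Finset.sum_range_succ, Nat.choose_self, Nat.cast_one, one_mul,
      add_sub_cancel_right]
    refine (dvd_iff_dvd_of_dvd_sub ?_).1 h3
    rw [← Finset.sum_sub_distrib]
    refine Finset.dvd_sum fun l hl => ?_
    rw [Finset.mem_range] at hl
    have hL := hle l (by omega)
    have h6 : 0 < p * (l + 1) := Nat.mul_pos hp.pos (by omega)
    rw [hval, ← sub_mul]
    obtain ⟨u, hu, h5⟩ := exists_dvd_choose_sub_choose hp j l
    have h7 := pow_dvd_succ_mul_apply hp hp3 hφ (k := p * (l + 1) - 1) (by omega)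
    rw [Nat.sub_add_cancel h6] at h7
    have h8 := h7.trans (mul_dvd_mul_right h5 (φ (X ^ (p * (l + 1) - 1))))
    rw [mul_assoc] at h8
    rw [Nat.cast_pow]
    exact IsCoprime.dvd_of_dvd_mul_left ((Prime.coprime_iff_not_dvd hp').2 hu).pow_left h8
  · have hL := hle l hl
    have h6 : 0 < p * (l + 1) := Nat.mul_pos hp.pos (by omega)
    have h1 := hn.trans ((mem_invariantFunctionals_iff.1 hφ).2 (p * (l + 1) - 1) (by omega))
    have h2 : d - (p * (l + 1) - 1) = p * (e - l + 1) - 1 := by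
      have : p * (e + 2) = p * (l + 1) + p * (e - l + 1) := by
        rw [← mul_add]
        congr 1
        omega
      omega
    have h3 : (-1 : ℤ) ^ (p * (l + 1) - 1) = (-1) ^ l := by
      have h4 : (-1 : ℤ) ^ (p * (l + 1) - 1) * (-1) = (-1) ^ l * (-1) := by
        rw [← pow_succ, ← pow_succ, Nat.sub_add_cancel h6, pow_mul, hp2.neg_one_pow]
      simpa using h4
    rw [hval, hval]
    rwa [h2, h3] at h1

theorem dvd_apply_sub_frobeniusFunctional_cartierFunctional (hp : p.Prime) (hp3 : 3 ≤ p)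
    {δ e : ℕ} (hδ : 1 ≤ δ) (hd1 : 1 ≤ d) (hd : d + 2 = p * (e + 2))
    (hφ : φ ∈ invariantFunctionals ((p ^ (δ + 1) : ℕ) : ℤ) d) {k : ℕ} (hk : k ≤ d) :
    (p : ℤ) ∣ φ (X ^ k) - frobeniusFunctional p (cartierFunctional p φ) (X ^ k) := by
  have hp' : Prime (p : ℤ) := Nat.prime_iff_prime_int.1 hp
  rw [frobeniusFunctional_X_pow]
  split_ifs with h
  · obtain ⟨t, ht⟩ := h
    have ht0 : t ≠ 0 := by rintro rfl; omega
    rw [ht, Nat.mul_div_cancel_left _ hp.pos, cartierFunctional, functionalOfSeq_X_pow,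
      Nat.sub_add_cancel (by omega), ← ht, Nat.add_sub_cancel, sub_self]
    exact dvd_zero _
  · rw [sub_zero]
    rcases hk.eq_or_lt with rfl | hk
    · exact (Int.natCast_dvd_natCast.2 (dvd_pow_self p (by omega))).trans
        (dvd_apply_X_pow_top hφ hd1)
    · have h1 := (dvd_pow_self (p : ℤ) (by omega : δ ≠ 0)).trans
        (pow_dvd_succ_mul_apply hp hp3 hφ hk)
      exact (hp'.dvd_mul.1 h1).resolve_left fun h2 => h (Int.natCast_dvd_natCast.1 h2)

end Descent

/-! ### Exclusion of the exceptional functionals and classification modulo `p^(k+1)` -/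

theorem smul_mem_invariantFunctionals {n : ℤ} {d : ℕ} {φ : ℤ[X] →ₗ[ℤ] ℤ} (m : ℤ)
    (hφ : φ ∈ invariantFunctionals n d) : m • φ ∈ invariantFunctionals (m * n) d := by
  refine ⟨fun f hf => ?_, fun f hf => ?_⟩
  · rw [LinearMap.smul_apply, LinearMap.smul_apply, ← smul_sub]
    exact mul_dvd_mul_left m (hφ.1 f hf)
  · rw [LinearMap.smul_apply, LinearMap.smul_apply, ← smul_sub]
    exact mul_dvd_mul_left m (hφ.2 f hf)

theorem mem_invariantFunctionals_of_smul {n m : ℤ} (hm : m ≠ 0) {d : ℕ} {φ ψ : ℤ[X] →ₗ[ℤ] ℤ}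
    (hψ : ψ ∈ invariantFunctionals (m * n) d)
    (h : ∀ f : ℤ[X], f.natDegree ≤ d → m * φ f = ψ f) : φ ∈ invariantFunctionals n d := by
  refine ⟨fun f hf => ?_, fun f hf => ?_⟩
  · have h1 := hψ.1 f hf
    rw [← h f hf, ← h _ (by rwa [natDegree_taylor]), ← mul_sub] at h1
    exact (mul_dvd_mul_iff_left hm).1 h1
  · have h1 := hψ.2 f hf
    rw [← h f hf, ← h _ (natDegree_signedReflect_le hf), ← mul_sub] at h1
    exact (mul_dvd_mul_iff_left hm).1 h1

theorem natDegree_X_add_one_pow_sub_sub_le (k : ℕ) :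
    ((X + 1 : ℤ[X]) ^ (k + 2) - X ^ (k + 2) - C ((k + 2 : ℕ) : ℤ) * X ^ (k + 1)).natDegree ≤ k := by
  rw [natDegree_le_iff_coeff_eq_zero]
  intro N hN
  rw [coeff_sub, coeff_sub, coeff_X_add_one_pow, coeff_X_pow, coeff_C_mul_X_pow]
  rcases (by omega : N = k + 1 ∨ N = k + 2 ∨ k + 2 < N) with rfl | rfl | h
  · simp [Nat.choose_succ_self_right]
    ring
  · simp
  · rw [Nat.choose_eq_zero_of_lt h, if_neg (by omega), if_neg (by omega)]
    simp

section

variable {p d : ℕ} {φ : ℤ[X] →ₗ[ℤ] ℤ}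

/-- The case where the Cartier transform has degree `0`. Only `φ(X^(p-1))` is in doubt; in the
translation congruence for `X^p` modulo `p^2` every other term vanishes, leaving `p φ(X^(p-1))`. -/
theorem dvd_apply_X_pow_of_degree_eq (hp : p.Prime) (hp3 : 3 ≤ p) (hd : d + 2 = p * 2)
    (hφ : φ ∈ invariantFunctionals ((p ^ (1 + 1) : ℕ) : ℤ) d) {k : ℕ} (hk : k ≤ d) :
    (p : ℤ) ∣ φ (X ^ k) := by
  have hp' : Prime (p : ℤ) := Nat.prime_iff_prime_int.1 hp
  have hpp : ((p ^ (1 + 1) : ℕ) : ℤ) = p * p := by push_cast; ring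
  have hpn : (p : ℤ) ∣ ((p ^ (1 + 1) : ℕ) : ℤ) := by rw [hpp]; exact dvd_mul_right _ _
  have hk1 : ∀ k < d, ¬ p ∣ k + 1 → (p : ℤ) ∣ φ (X ^ k) := by
    intro k hk h
    have h1 := pow_dvd_succ_mul_apply hp hp3 hφ hk
    rw [pow_one] at h1
    exact (hp'.dvd_mul.1 h1).resolve_left fun h2 => h (Int.natCast_dvd_natCast.1 h2)
  by_cases h : p ∣ k + 1
  swap
  · rcases hk.eq_or_lt with rfl | hk
    · exact hpn.trans (dvd_apply_X_pow_top hφ (by omega))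
    · exact hk1 k hk h
  obtain ⟨t, ht⟩ := h
  have ht1 : t = 1 := by
    have h1 : t < 2 := Nat.lt_of_mul_lt_mul_left (a := p) (by omega)
    have h2 : t ≠ 0 := by rintro rfl; omega
    omega
  rw [ht1, mul_one] at ht
  have h1 := dvd_sum_choose_mul hφ (k := p) (by omega)
  have h2 : ((p ^ (1 + 1) : ℕ) : ℤ) ∣ ∑ m ∈ Finset.range k, (p.choose m : ℤ) * φ (X ^ m) := by
    refine Finset.dvd_sum fun m hm => ?_
    rw [Finset.mem_range] at hm
    rcases Nat.eq_zero_or_pos m with rfl | hm0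
    · exact (dvd_apply_one hφ (by omega)).mul_left _
    · rw [hpp]
      exact mul_dvd_mul (Int.natCast_dvd_natCast.2 (hp.dvd_choose_self (by omega) (by omega)))
        (hk1 m (by omega) (Nat.not_dvd_of_pos_of_lt (by omega) (by omega)))
  rw [← ht, Finset.sum_range_succ, ht] at h1
  have h3 := (dvd_add_right h2).1 h1
  have h4 : p.choose k = p := by
    conv_lhs => rw [← ht]
    rw [Nat.choose_succ_self_right, ht]
  rw [h4, hpp] at h3
  exact (mul_dvd_mul_iff_left hp'.ne_zero).1 h3

/-- The Frobenius twist of a functional `lineCoeff` of degree `(p - 1) (m + 1)` does not lift to an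
invariant functional modulo `p ^ 2` if `p` does not divide `m`. -/
theorem dvd_of_eq_mul_frobenius_lineCoeff (hp : p.Prime) (hp3 : 3 < p) {m e : ℕ} (hm : 1 ≤ m)
    (hpm : ¬ p ∣ m) (he : e = (p - 1) * (m + 1)) (hd : d + 2 = p * (e + 2))
    (hφ : φ ∈ invariantFunctionals ((p ^ (1 + 1) : ℕ) : ℤ) d) {ε : ℤ}
    (hε : ∀ k ≤ d, (p : ℤ) ∣ φ (X ^ k) -
      ε * (if p ∣ k + 1 then lineCoeff p e ((k + 1) / p - 1) else 0)) :
    (p : ℤ) ∣ ε := by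
  have hp' : Prime (p : ℤ) := Nat.prime_iff_prime_int.1 hp
  have hp2 : Odd p := hp.odd_of_ne_two (by omega)
  have hpp : ((p ^ (1 + 1) : ℕ) : ℤ) = p * p := by push_cast; ring
  obtain ⟨r, hr⟩ : ∃ r, p = r + 1 := ⟨p - 1, by omega⟩
  have hpr : p - 1 = r := by omega
  -- The proof divides by `L^p`, which is invariant modulo `p^2`; the quotient degree `d'` satisfies
  -- `d' + 2 = p T` with `p ∤ T`.
  set T := r * m with hT
  have hT1 : 1 ≤ T := Nat.mul_le_mul (by omega : 1 ≤ r) hm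
  have heT : e = T + r := by rw [he, hpr, hT]; ring
  obtain ⟨d', hd'⟩ : ∃ d', d' + 2 = p * T := by
    refine ⟨p * T - 2, ?_⟩
    have : 4 * 1 ≤ p * T := Nat.mul_le_mul hp3 hT1
    omega
  have hdd : d = p * (p + 1) + d' := by
    have : d + 2 = p * (p + 1) + (d' + 2) := by rw [hd, hd', heT, hr]; ring
    omega
  have hd'1 : 1 ≤ d' := by
    have : 4 * 1 ≤ p * T := Nat.mul_le_mul hp3 hT1
    omega
  set A := dicksonL p ^ p with hA
  have hAdeg : A.natDegree ≤ p * p := natDegree_pow_le_of_le p (natDegree_dicksonL hp.one_lt).le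
  have hAdeg' : A.natDegree ≤ p * (p + 1) :=
    natDegree_pow_le_of_le p (natDegree_dicksonL_le p)
  have hAT : C ((p ^ (1 + 1) : ℕ) : ℤ) ∣ taylor 1 A - A := by
    have := C_dvd_taylor_pow (C_dvd_taylor_dicksonL hp) 1 1
    rwa [pow_one, mul_one] at this
  have hAR : signedReflect (p * (p + 1)) A = A :=
    signedReflect_pow (natDegree_dicksonL_le p) (signedReflect_dicksonL hp2) p
  have hAX : ∀ k, (p : ℤ) ∣ φ (A * X ^ k) - (φ (X ^ (k + p * p)) - φ (X ^ (k + p))) := by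
    intro k
    have h1 := C_dvd_pow_mul_sub_expand hp (dicksonL p) 1
    rw [mul_one, pow_one, ← hA] at h1
    have h2 := dvd_apply_sub (f := A * X ^ k) (g := expand ℤ p (dicksonL p) * X ^ k) φ
      (by rw [← sub_mul]; exact h1.mul_right _)
    have h3 : expand ℤ p (dicksonL p) * X ^ k = X ^ (k + p * p) - X ^ (k + p) := by
      rw [dicksonL, map_sub, map_pow, expand_X]
      ring
    rwa [h3, map_sub] at h2
  have hAt : ∀ t, 1 ≤ t → p * t + p * p ≤ d + 1 → (p : ℤ) ∣ φ (A * X ^ (p * t - 1)) -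
      ε * (lineCoeff p e (t + r) - lineCoeff p e t) := by
    intro t ht htd
    have hpt : 1 ≤ p * t := Nat.mul_le_mul hp.one_le ht
    have hpp' : p ≤ p * p := Nat.le_mul_of_pos_left _ hp.pos
    have h1 := hε (p * t - 1 + p * p) (by omega)
    have h2 := hε (p * t - 1 + p) (by omega)
    have e1 : p * t - 1 + p * p + 1 = p * (t + r + 1) := by
      rw [show p * (t + r + 1) = p * t + p * (r + 1) by ring, ← hr]
      omega
    have e2 : p * t - 1 + p + 1 = p * (t + 1) := by
      rw [mul_add, mul_one]
      omega
    rw [e1, if_pos (dvd_mul_right _ _), Nat.mul_div_cancel_left _ hp.pos, Nat.add_sub_cancel] at h1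
    rw [e2, if_pos (dvd_mul_right _ _), Nat.mul_div_cancel_left _ hp.pos, Nat.add_sub_cancel] at h2
    refine (dvd_add (hAX (p * t - 1)) (dvd_sub h1 h2)).trans (dvd_of_eq ?_)
    ring
  -- Modulo `p`, `L^p` is `X^(p^2) - X^p`, so these values are differences of line coefficients at
  -- `t + r` and `t`. They cancel for `1 ≤ t < T`; the first failure is at `t = T`, where `T + r =
  -- e` is the boundary exponent.
  have hAp : ∀ k ≤ d', (p : ℤ) ∣ φ (A * X ^ k) := by
    intro k hk
    have hkd : k + p * p ≤ d := by
      rw [hdd, mul_add]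
      omega
    by_cases h : p ∣ k + 1
    · obtain ⟨t, ht⟩ := h
      have ht0 : t ≠ 0 := by rintro rfl; omega
      have h1 := hAt t (by omega) (by omega)
      rw [← ht, Nat.add_sub_cancel] at h1
      have htT : t < T := Nat.lt_of_mul_lt_mul_left (a := p) (by omega)
      have h2 : lineCoeff p e (t + r) = lineCoeff p e t := by
        rw [lineCoeff, lineCoeff, hpr]
        refine if_congr ?_ rfl rfl
        rw [Nat.dvd_add_left dvd_rfl]
        refine and_congr_right fun _ => ?_
        omega
      rwa [h2, sub_self, mul_zero, sub_zero] at h1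
    · have hpp' : p ≤ p * p := Nat.le_mul_of_pos_left _ hp.pos
      have h1 := hε (k + p * p) hkd
      have h2 := hε (k + p) (by omega)
      rw [if_neg, mul_zero, sub_zero] at h1 h2
      · exact (dvd_iff_dvd_of_dvd_sub (hAX k)).2 (dvd_sub h1 h2)
      · rwa [add_right_comm, Nat.dvd_add_left dvd_rfl]
      · rwa [add_right_comm, Nat.dvd_add_left (dvd_mul_right _ _)]
  -- divide by `p`
  set ψ : ℤ[X] →ₗ[ℤ] ℤ := functionalOfSeq fun k => φ (A * X ^ k) / p with hψ
  have hψφ : ∀ f : ℤ[X], f.natDegree ≤ d' → (p : ℤ) * ψ f = (φ ∘ₗ LinearMap.mulLeft ℤ A) f := by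
    intro f hf
    -- Divisibility by `0` is equality, so the lemma extends an identity from powers of `X`.
    have h := dvd_apply_of_dvd_X_pow (n := 0)
      (φ := (p : ℤ) • ψ - φ ∘ₗ LinearMap.mulLeft ℤ A) (fun k hk => ?_) hf
    · rw [zero_dvd_iff] at h
      simpa [sub_eq_zero] using h
    · rw [zero_dvd_iff, LinearMap.sub_apply, LinearMap.smul_apply, hψ, functionalOfSeq_X_pow,
        smul_eq_mul, Int.mul_ediv_cancel' (hAp k hk), sub_eq_zero]
      rfl
  have hψinv : ψ ∈ invariantFunctionals p d' := by
    refine mem_invariantFunctionals_of_smul (m := p) hp'.ne_zero ?_ hψφ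
    rw [← hpp]
    exact mulLeft_mem_invariantFunctionals hAdeg' hAT hAR (hdd ▸ hφ)
  obtain ⟨χ, hχ, ε', h1, h2⟩ := exists_residueSpan_add_lineCoeff hp hp3 hd'1 hψinv
  -- An exceptional part would need `p - 1 ∣ d'`; as `d' + 2 = p (p - 1) m`, this gives `p - 1 ∣ 2`,
  -- which fails because `p > 3`.
  have hε' : ε' = 0 := by
    refine h2.resolve_right ?_
    rintro ⟨m', -, hm', -⟩
    have h3 : r ∣ d' + 2 := by rw [hd', hT]; exact (dvd_mul_right r m).mul_left p
    have h4 : r ∣ d' := by rw [hm', hpr]; exact dvd_mul_right _ _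
    have h5 := Nat.le_of_dvd (by norm_num) ((Nat.dvd_add_right h4).1 h3)
    omega
  -- Subtracting `p` times a lift of `χ` through `L^p` leaves `φ` unchanged modulo `p`, and makes it
  -- annihilate `L^p f` modulo `p^2` for all `f` of degree at most `d'`.
  obtain ⟨χ', hχ', h3⟩ := exists_residueSpan_dvd_dicksonL_mul_sub hp (s := p) hχ
  simp only [pow_zero, one_mul, zero_add, pow_one, ← hdd, ← hA] at hχ' h3
  have hχ'inv := residueSpan_le hp hp2 0 d hχ'
  rw [zero_add, pow_one] at hχ'inv
  set φ' := φ - (p : ℤ) • χ' with hφ'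
  have hφ'inv : φ' ∈ invariantFunctionals ((p ^ (1 + 1) : ℕ) : ℤ) d := by
    refine sub_mem hφ ?_
    rw [hpp]
    exact smul_mem_invariantFunctionals _ hχ'inv
  have hφ'A : ∀ f : ℤ[X], f.natDegree ≤ d' → ((p ^ (1 + 1) : ℕ) : ℤ) ∣ φ' (A * f) := by
    intro f hf
    have h4 : (p : ℤ) ∣ (ψ - χ) f := by
      refine dvd_apply_of_dvd_X_pow (fun k hk => ?_) hf
      have := h1 k hk
      rwa [hε', zero_mul, sub_zero] at this
    have h5 := h3 f hf
    have h6 := hψφ f hf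
    rw [LinearMap.comp_apply, LinearMap.mulLeft_apply] at h6
    rw [LinearMap.sub_apply] at h4
    rw [hpp, hφ', LinearMap.sub_apply, LinearMap.smul_apply, smul_eq_mul, ← h6, ← mul_sub]
    refine mul_dvd_mul_left _ ((dvd_sub h4 h5).trans (dvd_of_eq ?_))
    ring
  -- compare `A Y ^ (p T)` with its translate
  have h4 := hφ'inv.1 (A * X ^ (d' + 2)) (by
    have : (A * X ^ (d' + 2)).natDegree ≤ p * p + (d' + 2) :=
      natDegree_mul_le_of_le hAdeg (natDegree_X_pow_le _)
    rw [hdd, mul_add]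
    omega)
  rw [taylor_mul, taylor_X_pow, map_one] at h4
  have h5 := dvd_apply_sub (f := taylor 1 A * (X + 1) ^ (d' + 2)) (g := A * (X + 1) ^ (d' + 2)) φ'
    (by rw [← sub_mul]; exact hAT.mul_right _)
  have h6 := hφ'A _ (natDegree_X_add_one_pow_sub_sub_le d')
  -- The translate of `A X^(d'+2)` leaves only the term `(d' + 2) A X^(d'+1)`. Since `d' + 2 = p T`
  -- with `p ∤ T`, one factor `p` cancels and the value at `A X^(d'+1)`, which is `-ε` modulo `p`,
  -- vanishes.
  have h7 : ((p ^ (1 + 1) : ℕ) : ℤ) ∣ ((d' + 2 : ℕ) : ℤ) * φ' (A * X ^ (d' + 1)) := by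
    have : A * (C ((d' + 2 : ℕ) : ℤ) * X ^ (d' + 1)) =
        ((d' + 2 : ℕ) : ℤ) • (A * X ^ (d' + 1)) := by
      rw [smul_eq_C_mul]; ring
    rw [mul_sub, mul_sub, map_sub, map_sub, this, map_smul, smul_eq_mul] at h6
    refine (dvd_sub (dvd_sub h4 h5) h6).trans (dvd_of_eq ?_)
    ring
  rw [hd', hpp, Nat.cast_mul, mul_assoc, mul_dvd_mul_iff_left hp'.ne_zero] at h7
  have h8 : (p : ℤ) ∣ φ' (A * X ^ (d' + 1)) := by
    refine (hp'.dvd_mul.1 h7).resolve_left fun h => ?_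
    have h9 := Int.natCast_dvd_natCast.1 h
    rw [hT] at h9
    rcases (Nat.Prime.dvd_mul hp).1 h9 with h10 | h10
    · have := Nat.le_of_dvd (by omega) h10
      omega
    · exact hpm h10
  have h9 : (p : ℤ) ∣ φ (A * X ^ (d' + 1)) := by
    rw [hφ', LinearMap.sub_apply, LinearMap.smul_apply, smul_eq_mul] at h8
    exact (dvd_iff_dvd_of_dvd_sub (h8.trans (dvd_of_eq rfl))).2 (dvd_mul_right _ _)
  have h10 := hAt T hT1 (by rw [← hd', hdd, mul_add]; omega)
  rw [← hd', show d' + 2 - 1 = d' + 1 by omega] at h10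
  have h11 : lineCoeff p e (T + r) = 0 := by
    rw [lineCoeff, if_neg]
    rintro ⟨-, -, h⟩
    omega
  have h12 : lineCoeff p e T = 1 := by
    rw [lineCoeff, if_pos ⟨hpr ▸ dvd_mul_right _ _, by omega, by omega⟩]
  rw [h11, h12, zero_sub, mul_neg, mul_one, sub_neg_eq_add] at h10
  exact (dvd_add_right h9).1 h10

/-- Invariant functionals modulo `p ^ (k + 1)`, with `k ≥ 1`, reduce modulo `p` to combinations of
the classes of `1 / (L ^ (p ^ k i) Q ^ (p ^ k j))`. -/
theorem exists_residueSpan_dvd_sub (hp : p.Prime) (hp3 : 3 < p) {k : ℕ} (hk : 1 ≤ k)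
    (hd : 1 ≤ d) (hφ : φ ∈ invariantFunctionals ((p ^ (k + 1) : ℕ) : ℤ) d) :
    ∃ ψ ∈ residueSpan p k d, ∀ l ≤ d, (p : ℤ) ∣ φ (X ^ l) - ψ (X ^ l) := by
  have hp2 : Odd p := hp.odd_of_ne_two (by omega)
  have hzero : ∀ k d (φ : ℤ[X] →ₗ[ℤ] ℤ), (∀ l ≤ d, (p : ℤ) ∣ φ (X ^ l)) →
      ∃ ψ ∈ residueSpan p k d, ∀ l ≤ d, (p : ℤ) ∣ φ (X ^ l) - ψ (X ^ l) := by
    intro k d φ h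
    exact ⟨0, zero_mem _, fun l hl => by simpa using h l hl⟩
  have hdiv : ∀ d e l, d + 2 = p * (e + 2) → l ≤ d → (l + 1) / p - 1 ≤ e := by
    intro d e l hde hl
    have : (l + 1) / p < e + 2 := by
      rw [Nat.div_lt_iff_lt_mul hp.pos, mul_comm, ← hde]
      omega
    omega
  induction k, hk using Nat.le_induction generalizing d φ with
  | base =>
    rcases dvd_apply_X_pow_or_exists_degree hp hp3.le le_rfl hd hφ with h | ⟨e, he⟩
    · exact hzero _ _ _ h
    -- The classification modulo `p` needs positive degree, so a Cartier transform of degree `0` is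
    -- treated apart.
    rcases Nat.eq_zero_or_pos e with rfl | he1
    · exact hzero _ _ _ fun l hl => dvd_apply_X_pow_of_degree_eq hp hp3.le he hφ hl
    have hC := cartierFunctional_mem hp hp3.le he hφ
    rw [pow_one] at hC
    obtain ⟨ψ, hψ, ε, h1, h2⟩ := exists_residueSpan_add_lineCoeff hp hp3 he1 hC
    obtain ⟨χ, hχ, h3⟩ := exists_residueSpan_frobenius hp he hψ
    have h4 : ∀ l ≤ d, (p : ℤ) ∣ (φ - χ) (X ^ l) -
        ε * (if p ∣ l + 1 then lineCoeff p e ((l + 1) / p - 1) else 0) := by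
      intro l hl
      have h5 := dvd_apply_sub_frobeniusFunctional_cartierFunctional hp hp3.le le_rfl hd he hφ hl
      have h6 := h3 l hl
      have h7 := h1 _ (hdiv d e l he hl)
      rw [frobeniusFunctional_X_pow] at h5 h6
      rw [LinearMap.sub_apply]
      split_ifs at h5 h6 ⊢
      · exact (dvd_add (dvd_add h5 h6) h7).trans (dvd_of_eq (by ring))
      · exact (dvd_add h5 h6).trans (dvd_of_eq (by ring))
    have hε : (p : ℤ) ∣ ε := by
      rcases h2 with rfl | ⟨m, hm, hem, hpm⟩
      · exact dvd_zero _
      · exact dvd_of_eq_mul_frobenius_lineCoeff hp hp3 hm hpm hem he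
          (sub_mem hφ (residueSpan_le hp hp2 _ _ hχ)) h4
    exact ⟨χ, hχ, fun l hl => (dvd_iff_dvd_of_dvd_sub (h4 l hl)).2 (hε.mul_right _)⟩
  | succ k hk ih =>
    rcases dvd_apply_X_pow_or_exists_degree hp hp3.le (by omega) hd hφ with h | ⟨e, he⟩
    · exact hzero _ _ _ h
    rcases Nat.eq_zero_or_pos e with rfl | he1
    · refine hzero _ _ _ fun l hl => dvd_apply_X_pow_of_degree_eq hp hp3.le he
        (invariantFunctionals_mono ?_ hφ) hl
      exact Int.natCast_dvd_natCast.2 (pow_dvd_pow p (by omega))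
    obtain ⟨ψ, hψ, h1⟩ := ih he1 (cartierFunctional_mem hp hp3.le he hφ)
    obtain ⟨χ, hχ, h3⟩ := exists_residueSpan_frobenius hp he hψ
    refine ⟨χ, hχ, fun l hl => ?_⟩
    have h5 := dvd_apply_sub_frobeniusFunctional_cartierFunctional hp hp3.le (by omega) hd he hφ hl
    have h6 := h3 l hl
    have h7 := h1 _ (hdiv d e l he hl)
    rw [frobeniusFunctional_X_pow] at h5 h6
    split_ifs at h5 h6
    · exact (dvd_add (dvd_add h5 h6) h7).trans (dvd_of_eq (by ring))
    · exact (dvd_add h5 h6).trans (dvd_of_eq (by ring))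

end

/-! ### Independence of the residue classes modulo `p` -/

theorem IsDicksonResidue.dvd_apply_of_lt {p : ℕ} (hp : p.Prime) {n : ℤ} {i j i' j' : ℕ}
    {φ : ℤ[X] →ₗ[ℤ] ℤ} (hφ : IsDicksonResidue p n i j φ) (hi : i < i')
    (h : i * (p + 1) + j * (p * (p - 1)) = i' * (p + 1) + j' * (p * (p - 1))) (hj' : 1 ≤ j') :
    n ∣ φ (dicksonL p ^ i' * X ^ (j' * (p * (p - 1)) - 1)) := by
  obtain ⟨r, rfl⟩ : ∃ r, i' = i + (r + 1) := ⟨i' - i - 1, by omega⟩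
  have hb : 1 ≤ j' * (p * (p - 1)) := by
    have := hp.two_le
    exact Nat.mul_le_mul hj' (Nat.mul_le_mul hp.one_le (by omega : 1 ≤ p - 1))
  rw [pow_add, mul_assoc]
  refine hφ.dvd_dicksonL _ ?_
  have h1 : (dicksonL p ^ (r + 1) * X ^ (j' * (p * (p - 1)) - 1) : ℤ[X]).natDegree ≤
      (r + 1) * p + (j' * (p * (p - 1)) - 1) :=
    natDegree_mul_le_of_le (natDegree_pow_le_of_le _ (natDegree_dicksonL hp.one_lt).le)
      (natDegree_X_pow_le _)
  have h2 : (i + (r + 1)) * (p + 1) = i * (p + 1) + ((r + 1) * p + (r + 1)) := by ring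
  omega

/-- Triangularity: at the normalising element of a pair `s`, the class of `s` takes the value `1`
and the classes with smaller exponent of `L` vanish. So it suffices to test at a nonzero coefficient
with the largest such exponent. -/
theorem dvd_coeff_of_dvd_sum_dicksonResidue {p : ℕ} (hp : p.Prime) (k d : ℕ)
    (S : Finset (ℕ × ℕ)) (hS : ∀ t ∈ S, 1 ≤ t.1 ∧ 1 ≤ t.2 ∧
      d + 2 = p ^ k * (t.1 * (p + 1) + t.2 * (p * (p - 1)))) (x : ℕ × ℕ → ℤ)
    (h : ∀ l ≤ d, (p : ℤ) ∣
      ∑ t ∈ S, x t * dicksonResidue p (k + 1) (p ^ k * t.1) (p ^ k * t.2) (X ^ l)) :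
    ∀ t ∈ S, (p : ℤ) ∣ x t := by
  by_contra! hcon
  obtain ⟨t₁, ht₁, hx₁⟩ := hcon
  have hq : 1 ≤ p ^ k := Nat.one_le_pow _ _ hp.pos
  have hpn : (p : ℤ) ∣ ((p ^ (k + 1) : ℕ) : ℤ) :=
    Int.natCast_dvd_natCast.2 (dvd_pow_self p (by omega))
  obtain ⟨s, hs, hmax⟩ := (S.filter fun t => ¬ (p : ℤ) ∣ x t).exists_max_image (fun t => t.1)
    ⟨t₁, Finset.mem_filter.2 ⟨ht₁, hx₁⟩⟩
  rw [Finset.mem_filter] at hs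
  obtain ⟨hsS, hxs⟩ := hs
  obtain ⟨hs1, hs2, hsd⟩ := hS s hsS
  have hb : 1 ≤ p * (p - 1) := by
    have := hp.two_le
    exact Nat.mul_le_mul hp.one_le (by omega : 1 ≤ p - 1)
  have hI : 1 ≤ p ^ k * s.1 := Nat.mul_le_mul hq hs1
  have hJ : 1 ≤ p ^ k * s.2 := Nat.mul_le_mul hq hs2
  have hsd' : d + 2 = p ^ k * s.1 * (p + 1) + p ^ k * s.2 * (p * (p - 1)) := by rw [hsd]; ring
  obtain ⟨f, hf⟩ : ∃ f : ℤ[X],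
      f = dicksonL p ^ (p ^ k * s.1) * X ^ (p ^ k * s.2 * (p * (p - 1)) - 1) := ⟨_, rfl⟩
  have hfdeg : f.natDegree ≤ d := by
    have h1 := natDegree_dicksonL_pow_mul_X_pow_add_two_le hp hI hJ
    rw [← hsd', ← hf] at h1
    omega
  have h1 : (p : ℤ) ∣ (∑ t ∈ S, x t • dicksonResidue p (k + 1) (p ^ k * t.1) (p ^ k * t.2)) f := by
    refine dvd_apply_of_dvd_X_pow (fun l hl => ?_) hfdeg
    simpa using h l hl
  rw [LinearMap.sum_apply, ← Finset.add_sum_erase _ _ hsS] at h1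
  have h2 : (p : ℤ) ∣ ∑ t ∈ S.erase s,
      (x t • dicksonResidue p (k + 1) (p ^ k * t.1) (p ^ k * t.2)) f := by
    refine Finset.dvd_sum fun t ht => ?_
    rw [Finset.mem_erase] at ht
    obtain ⟨hts, htS⟩ := ht
    obtain ⟨ht1, ht2, htd⟩ := hS t htS
    rw [LinearMap.smul_apply, smul_eq_mul, hf]
    by_cases hx : (p : ℤ) ∣ x t
    · exact hx.mul_right _
    refine Dvd.dvd.mul_left (hpn.trans ?_) _
    have hle := hmax t (Finset.mem_filter.2 ⟨htS, hx⟩)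
    have hsum : t.1 * (p + 1) + t.2 * (p * (p - 1)) = s.1 * (p + 1) + s.2 * (p * (p - 1)) :=
      Nat.eq_of_mul_eq_mul_left (by omega) (htd.symm.trans hsd)
    have hlt : t.1 < s.1 := by
      refine hle.lt_of_ne fun he => hts (Prod.ext he ?_)
      rw [he] at hsum
      exact Nat.eq_of_mul_eq_mul_right (by omega) (Nat.add_left_cancel hsum)
    refine (isDicksonResidue hp (k + 1) (Nat.mul_le_mul hq ht1)
      (Nat.mul_le_mul hq ht2)).dvd_apply_of_lt hp (Nat.mul_lt_mul_of_pos_left hlt (by omega)) ?_ hJ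
    rw [← hsd', htd]
    ring
  have h3 := (dvd_add_left h2).1 h1
  rw [LinearMap.smul_apply, smul_eq_mul, hf] at h3
  have h4 := hpn.trans (isDicksonResidue hp (k + 1) hI hJ).normalized
  have hp' : Prime (p : ℤ) := Nat.prime_iff_prime_int.1 hp
  rcases hp'.dvd_mul.1 h3 with h5 | h5
  · exact hxs h5
  · exact hp'.not_dvd_one ((dvd_sub_right h5).1 h4)

/-! ### The rank of a finite `ℤ/p^δ`-module through functionals -/

/-- Self-injectivity of `ℤ/n`. For the ideal `(a)` put `m = gcd(a, n)`: the image of `a` is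
annihilated by `n / m`, hence is a multiple of `m`, and `m` is a multiple of `a` by Bézout. -/
theorem baer_zmod (n : ℕ) [NeZero n] : Module.Baer (ZMod n) (ZMod n) := by
  intro I g
  have : IsPrincipalIdealRing (ZMod n) :=
    IsPrincipalIdealRing.of_surjective (Int.castRingHom (ZMod n)) ZMod.intCast_surjective
  obtain ⟨a, ha⟩ := (IsPrincipalIdealRing.principal I).principal
  have haI : a ∈ I := by rw [ha]; exact Submodule.mem_span_singleton_self a
  obtain ⟨u, hu⟩ : ∃ u, g ⟨a, haI⟩ = u * a := by
    set y := g ⟨a, haI⟩ with hy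
    set m := Nat.gcd a.val n with hm
    obtain ⟨c, hc⟩ : m ∣ n := Nat.gcd_dvd_right _ _
    have hm0 : 0 < m := Nat.gcd_pos_of_pos_right _ (NeZero.pos n)
    have hc0 : 0 < c := Nat.pos_of_ne_zero (by rintro rfl; exact NeZero.ne n (by simpa using hc))
    have hca : (c : ZMod n) * a = 0 := by
      obtain ⟨b, hb⟩ : m ∣ a.val := Nat.gcd_dvd_left _ _
      rw [← ZMod.natCast_zmod_val a, hb, ← Nat.cast_mul, ZMod.natCast_eq_zero_iff]
      exact ⟨b, by rw [← mul_assoc, mul_comm c m, ← hc]⟩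
    have hcy : (c : ZMod n) * y = 0 := by
      have : (c : ZMod n) • (⟨a, haI⟩ : I) = 0 := Subtype.ext hca
      rw [hy, ← smul_eq_mul, ← map_smul, this, map_zero]
    have hmy : m ∣ y.val := by
      rw [← ZMod.natCast_zmod_val y, ← Nat.cast_mul, ZMod.natCast_eq_zero_iff] at hcy
      have h1 : c * m ∣ c * y.val := by rwa [mul_comm c m, ← hc]
      exact Nat.dvd_of_mul_dvd_mul_left hc0 h1
    obtain ⟨t, ht⟩ := hmy
    have hbez : (m : ZMod n) = (Nat.gcdA a.val n : ZMod n) * a := by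
      have := congrArg (Int.cast : ℤ → ZMod n) (Nat.gcd_eq_gcd_ab a.val n)
      push_cast at this
      rw [hm, this, ZMod.natCast_self, ZMod.natCast_zmod_val]
      ring
    refine ⟨t * Nat.gcdA a.val n, ?_⟩
    rw [mul_assoc, ← hbez, ← ZMod.natCast_zmod_val y, ht]
    push_cast
    ring
  refine ⟨LinearMap.mulLeft (ZMod n) u, fun x hx => ?_⟩
  obtain ⟨r, rfl⟩ := Submodule.mem_span_singleton.1 (ha ▸ hx)
  have : (⟨r • a, hx⟩ : I) = r • ⟨a, haI⟩ := rfl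
  rw [this, g.map_smul, hu, LinearMap.mulLeft_apply, smul_eq_mul, smul_eq_mul]
  ring

theorem isUnit_zmod_of_castHom_ne_zero {p δ : ℕ} (hp : p.Prime) (hδ : 1 ≤ δ) {x : ZMod (p ^ δ)}
    (hx : ZMod.castHom (dvd_pow_self p (by omega : δ ≠ 0)) (ZMod p) x ≠ 0) : IsUnit x := by
  have : NeZero (p ^ δ) := ⟨pow_ne_zero _ hp.ne_zero⟩
  obtain ⟨m, rfl⟩ := ZMod.natCast_zmod_surjective x
  rw [map_natCast] at hx
  rw [ZMod.isUnit_iff_coprime]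
  refine Nat.Coprime.pow_right _ (Nat.Coprime.symm ((Nat.Prime.coprime_iff_not_dvd hp).2 ?_))
  rwa [← ZMod.natCast_eq_zero_iff]

/-- The rank of the free part of a finite `ℤ/p^δ`-module is the dimension of the space of
functionals modulo `p` that lift modulo `p^δ`. -/
theorem finrank_eq_card_of_functionals {p δ : ℕ} (hp : p.Prime) (hδ : 1 ≤ δ) {N : Type}
    [AddCommGroup N] [Module (ZMod (p ^ δ)) N] [Module.Finite (ZMod (p ^ δ)) N]
    {ι : Type} [Fintype ι] (l : ι → N →ₗ[ZMod (p ^ δ)] ZMod (p ^ δ))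
    (hind : ∀ x : ι → ZMod p, (∀ v : N, ∑ i, x i *
      ZMod.castHom (dvd_pow_self p (by omega : δ ≠ 0)) (ZMod p) (l i v) = 0) → x = 0)
    (hspan : ∀ μ : N →ₗ[ZMod (p ^ δ)] ZMod (p ^ δ), ∃ x : ι → ZMod p, ∀ v : N,
      ZMod.castHom (dvd_pow_self p (by omega : δ ≠ 0)) (ZMod p) (μ v) = ∑ i, x i *
      ZMod.castHom (dvd_pow_self p (by omega : δ ≠ 0)) (ZMod p) (l i v)) :
    Module.finrank (ZMod (p ^ δ)) N = Fintype.card ι := by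
  classical
  have : NeZero (p ^ δ) := ⟨pow_ne_zero _ hp.ne_zero⟩
  have : Fact p.Prime := ⟨hp⟩
  have : Fact (1 < p ^ δ) := ⟨Nat.one_lt_pow (by omega) hp.one_lt⟩
  set π := ZMod.castHom (dvd_pow_self p (by omega : δ ≠ 0)) (ZMod p)
  have hπ : Function.Surjective π := ZMod.castHom_surjective _
  apply le_antisymm
  · obtain ⟨s, hs⟩ : ∃ s, s = Module.finrank (ZMod (p ^ δ)) N := ⟨_, rfl⟩
    rw [← hs]
    obtain ⟨v, hv⟩ := exists_linearIndependent_of_le_finrank hs.le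
    -- Self-injectivity extends the coordinate functionals of the independent family to `N`; their
    -- reductions modulo `p` are then independent too.
    have hμ : ∀ i : Fin s, ∃ μ : N →ₗ[ZMod (p ^ δ)] ZMod (p ^ δ),
        ∀ j, μ (v j) = if j = i then 1 else 0 := by
      intro i
      obtain ⟨μ, hμ⟩ := (baer_zmod (p ^ δ)).extension_property
        (Fintype.linearCombination (ZMod (p ^ δ)) v)
        hv.fintypeLinearCombination_injective (LinearMap.proj i)
      refine ⟨μ, fun j => ?_⟩
      have := LinearMap.congr_fun hμ (Pi.single j 1)
      rw [LinearMap.comp_apply, Fintype.linearCombination_apply_single, one_smul,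
        LinearMap.proj_apply, Pi.single_apply] at this
      rw [this]
      simp [eq_comm]
    choose μ hμ using hμ
    choose x hx using fun i => hspan (μ i)
    have hli : LinearIndependent (ZMod p) x := by
      rw [Fintype.linearIndependent_iff]
      intro y hy j
      have h1 : ∑ i, y i * π (μ i (v j)) = y j := by
        rw [Finset.sum_eq_single j]
        · simp [hμ]
        · intro i _ hij
          simp [hμ, hij.symm]
        · simp
      rw [← h1]
      simp only [hx, Finset.mul_sum]
      rw [Finset.sum_comm]
      refine Finset.sum_eq_zero fun t _ => ?_
      have h2 := congrFun hy t
      simp only [Finset.sum_apply, Pi.smul_apply, smul_eq_mul, Pi.zero_apply] at h2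
      rw [← zero_mul (π (l t (v j))), ← h2, Finset.sum_mul]
      exact Finset.sum_congr rfl fun i _ => by ring
    simpa using hli.fintype_card_le_finrank
  -- Independence modulo `p` makes the evaluation map `N → 𝔽_p^ι` surjective. Preimages of the
  -- standard basis give a matrix of values that is the identity modulo `p`, hence invertible, so
  -- they are independent.
  · set T : Set (ι → ZMod p) := Set.range fun v : N => fun i => π (l i v) with hT
    have htop : Submodule.span (ZMod p) T = ⊤ := by
      by_contra hne
      obtain ⟨f, hf0, hf⟩ := Submodule.exists_le_ker_of_lt_top _ (lt_top_iff_ne_top.2 hne)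
      refine hf0 ?_
      have h1 : ∀ w, f w = ∑ i, f (Pi.single i 1) * w i := by
        intro w
        conv_lhs => rw [← (Pi.basisFun (ZMod p) ι).sum_repr w, map_sum]
        refine Finset.sum_congr rfl fun i _ => ?_
        rw [map_smul, smul_eq_mul, mul_comm, Pi.basisFun_apply, Pi.basisFun_repr]
      have h2 := hind (fun i => f (Pi.single i 1)) fun v => by
        rw [← h1 fun i => π (l i v)]
        exact hf (Submodule.subset_span ⟨v, rfl⟩)
      ext i
      simpa using congrFun h2 i
    have hrange : ∀ w : ι → ZMod p, ∃ v : N, ∀ i, π (l i v) = w i := by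
      intro w
      have hw : w ∈ Submodule.span (ZMod p) T := htop ▸ Submodule.mem_top
      induction hw using Submodule.span_induction with
      | mem w hw =>
        obtain ⟨v, rfl⟩ := hw
        exact ⟨v, fun i => rfl⟩
      | zero => exact ⟨0, by simp⟩
      | add w w' _ _ h h' =>
        obtain ⟨v, hv⟩ := h
        obtain ⟨v', hv'⟩ := h'
        exact ⟨v + v', fun i => by rw [map_add, map_add, hv, hv', Pi.add_apply]⟩
      | smul c w _ h =>
        obtain ⟨v, hv⟩ := h
        obtain ⟨c, rfl⟩ := hπ c
        exact ⟨c • v, fun i => by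
          rw [map_smul, smul_eq_mul, map_mul, hv, Pi.smul_apply, smul_eq_mul]⟩
    choose v hv using fun i : ι => hrange (Pi.single i 1)
    set B : Matrix ι ι (ZMod (p ^ δ)) := Matrix.of fun i j => l i (v j) with hB
    have hBdet : IsUnit B.det := by
      refine isUnit_zmod_of_castHom_ne_zero hp hδ ?_
      change π B.det ≠ 0
      rw [RingHom.map_det]
      have : π.mapMatrix B = 1 := by
        ext i j
        simp [hB, hv, Matrix.one_apply, Pi.single_apply]
      rw [this, Matrix.det_one]
      exact one_ne_zero
    have hli : LinearIndependent (ZMod (p ^ δ)) v := by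
      rw [Fintype.linearIndependent_iff]
      intro y hy
      have h1 : B.mulVec y = 0 := by
        ext i
        have := congrArg (l i) hy
        rw [map_sum, map_zero] at this
        rw [Matrix.mulVec, dotProduct, Pi.zero_apply, ← this]
        refine Finset.sum_congr rfl fun j _ => ?_
        rw [map_smul, smul_eq_mul, mul_comm]
        rfl
      have h2 := Matrix.mulVec_injective_of_isUnit ((Matrix.isUnit_iff_isUnit_det B).2 hBdet)
        (h1.trans (Matrix.mulVec_zero B).symm)
      exact congrFun h2
    exact hli.fintype_card_le_finrank

/-! ### Generators of `SL₂(ℤ/p^δ)` -/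

section Generators

variable {R : Type} [CommRing R]

/-- The transvection `(1 s; 0 1)`. -/
def upperTransvection (s : R) : Matrix.SpecialLinearGroup (Fin 2) R :=
  ⟨!![1, s; 0, 1], by simp [Matrix.det_fin_two]⟩

/-- The transvection `(1 0; s 1)`. -/
def lowerTransvection (s : R) : Matrix.SpecialLinearGroup (Fin 2) R :=
  ⟨!![1, 0; s, 1], by simp [Matrix.det_fin_two]⟩

/-- The element `(0 -1; 1 0)`. -/
def weylElement (R : Type) [CommRing R] : Matrix.SpecialLinearGroup (Fin 2) R :=
  ⟨!![0, -1; 1, 0], by simp [Matrix.det_fin_two]⟩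

theorem coe_upperTransvection (s : R) : (upperTransvection s).1 = !![1, s; 0, 1] := rfl

theorem coe_lowerTransvection (s : R) : (lowerTransvection s).1 = !![1, 0; s, 1] := rfl

theorem coe_weylElement : (weylElement R).1 = !![0, -1; 1, 0] := rfl

theorem upperTransvection_add (s t : R) :
    upperTransvection (s + t) = upperTransvection s * upperTransvection t := by
  ext i j
  fin_cases i <;> fin_cases j <;> simp [coe_upperTransvection,
    Matrix.SpecialLinearGroup.coe_mul, Matrix.mul_apply, add_comm]

theorem lowerTransvection_eq (s : R) :
    lowerTransvection s = weylElement R * upperTransvection (-s) * (weylElement R)⁻¹ := by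
  rw [eq_mul_inv_iff_mul_eq]
  ext i j
  fin_cases i <;> fin_cases j <;>
    simp [coe_upperTransvection, coe_lowerTransvection, coe_weylElement,
      Matrix.SpecialLinearGroup.coe_mul, Matrix.mul_apply]

theorem eq_mul_transvections_of_isUnit (g : Matrix.SpecialLinearGroup (Fin 2) R)
    (hc : IsUnit (g.1 1 0)) : ∃ x y : R,
      g = upperTransvection x * lowerTransvection (g.1 1 0) * upperTransvection y := by
  obtain ⟨u, hu⟩ := hc.exists_left_inv
  have hdet := g.2
  rw [Matrix.det_fin_two] at hdet
  refine ⟨(g.1 0 0 - 1) * u, (g.1 1 1 - 1) * u, ?_⟩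
  ext i j
  fin_cases i <;> fin_cases j
  · simp [coe_upperTransvection, coe_lowerTransvection, Matrix.SpecialLinearGroup.coe_mul,
      Matrix.mul_apply]
    linear_combination (1 - g.1 0 0) * hu
  · simp [coe_upperTransvection, coe_lowerTransvection, Matrix.SpecialLinearGroup.coe_mul,
      Matrix.mul_apply]
    linear_combination (-(g.1 0 1) - (g.1 0 0 - 1) * (g.1 1 1 - 1) * u) * hu - u * hdet
  · simp [coe_upperTransvection, coe_lowerTransvection, Matrix.SpecialLinearGroup.coe_mul,
      Matrix.mul_apply]
  · simp [coe_upperTransvection, coe_lowerTransvection, Matrix.SpecialLinearGroup.coe_mul,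
      Matrix.mul_apply]
    linear_combination (1 - g.1 1 1) * hu

/-- An element whose lower left entry is a unit is a product of transvections. Otherwise that entry
is `0` modulo `p`, the upper left entry is a unit, and adding the first row to the second reduces to
the first case. -/
theorem subgroup_eq_top_of_mem {p δ : ℕ} (hp : p.Prime) (hδ : 1 ≤ δ)
    (H : Subgroup (Matrix.SpecialLinearGroup (Fin 2) (ZMod (p ^ δ))))
    (hU : upperTransvection 1 ∈ H) (hW : weylElement _ ∈ H) : H = ⊤ := by
  have : NeZero (p ^ δ) := ⟨pow_ne_zero _ hp.ne_zero⟩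
  have : Fact p.Prime := ⟨hp⟩
  have hUs : ∀ s, upperTransvection s ∈ H := by
    intro s
    obtain ⟨m, rfl⟩ := ZMod.natCast_zmod_surjective s
    induction m with
    | zero =>
      convert H.one_mem
      ext i j
      fin_cases i <;> fin_cases j <;> simp [upperTransvection]
    | succ m ih =>
      rw [Nat.cast_succ, upperTransvection_add]
      exact H.mul_mem ih hU
  have hVs : ∀ s, lowerTransvection s ∈ H := fun s => by
    rw [lowerTransvection_eq]
    exact H.mul_mem (H.mul_mem hW (hUs _)) (H.inv_mem hW)
  have hunit : ∀ g : Matrix.SpecialLinearGroup (Fin 2) (ZMod (p ^ δ)), IsUnit (g.1 1 0) →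
      g ∈ H := by
    intro g hg
    obtain ⟨x, y, h⟩ := eq_mul_transvections_of_isUnit g hg
    rw [h]
    exact H.mul_mem (H.mul_mem (hUs _) (hVs _)) (hUs _)
  rw [eq_top_iff]
  intro g _
  by_cases hc : IsUnit (g.1 1 0)
  · exact hunit g hc
  have h1 : lowerTransvection 1 * g ∈ H := by
    refine hunit _ (isUnit_zmod_of_castHom_ne_zero hp hδ ?_)
    set π := ZMod.castHom (dvd_pow_self p (by omega : δ ≠ 0)) (ZMod p)
    have hc0 : π (g.1 1 0) = 0 := by
      by_contra h
      exact hc (isUnit_zmod_of_castHom_ne_zero hp hδ h)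
    have hdet := congrArg π g.2
    rw [Matrix.det_fin_two, map_sub, map_mul, map_mul, hc0, mul_zero, sub_zero, map_one] at hdet
    have h2 : (lowerTransvection 1 * g).1 1 0 = g.1 0 0 + g.1 1 0 := by
      simp [coe_lowerTransvection, Matrix.SpecialLinearGroup.coe_mul, Matrix.mul_apply]
    rw [h2, map_add, hc0, add_zero]
    exact left_ne_zero_of_mul_eq_one hdet
  exact (H.mul_mem_cancel_left (hVs 1)).1 h1

end Generators

/-! ### Functionals on the coinvariants -/

section Coinvariants

variable {R : Type} [CommRing R]

theorem polyAction_apply_X_pow_mul_X_pow (g : Matrix.SpecialLinearGroup (Fin 2) R) (a b : ℕ) :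
    polyAction R g (MvPolynomial.X 0 ^ a * MvPolynomial.X 1 ^ b) =
      (g.1 0 0 • MvPolynomial.X 0 + g.1 1 0 • MvPolynomial.X 1) ^ a *
        (g.1 0 1 • MvPolynomial.X 0 + g.1 1 1 • MvPolynomial.X 1) ^ b := by
  change polySubst g.1 _ = _
  rw [map_mul, map_pow, map_pow, polySubst_X, polySubst_X]

theorem polyAction_upperTransvection (a b : ℕ) :
    polyAction R (upperTransvection 1) (MvPolynomial.X 0 ^ a * MvPolynomial.X 1 ^ b) =
      ∑ m ∈ Finset.range (b + 1), (b.choose m : R) •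
        (MvPolynomial.X 0 ^ (a + b - m) * MvPolynomial.X 1 ^ m) := by
  rw [polyAction_apply_X_pow_mul_X_pow]
  simp only [coe_upperTransvection, Matrix.of_apply, Matrix.cons_val_zero,
    Matrix.cons_val_one, one_smul,
    zero_smul, add_zero, Matrix.cons_val', Matrix.cons_val_fin_one]
  rw [add_comm, add_pow, Finset.mul_sum]
  refine Finset.sum_congr rfl fun m hm => ?_
  rw [Finset.mem_range] at hm
  rw [Nat.add_sub_assoc (by omega), pow_add, MvPolynomial.smul_eq_C_mul, map_natCast]
  ring

theorem polyAction_weylElement (a b : ℕ) :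
    polyAction R (weylElement R) (MvPolynomial.X 0 ^ a * MvPolynomial.X 1 ^ b) =
      (-1 : R) ^ b • (MvPolynomial.X 0 ^ b * MvPolynomial.X 1 ^ a) := by
  rw [polyAction_apply_X_pow_mul_X_pow]
  simp only [coe_weylElement, Matrix.of_apply, Matrix.cons_val_zero,
    Matrix.cons_val_one, one_smul,
    zero_smul, add_zero, zero_add, neg_smul, Matrix.cons_val', Matrix.cons_val_fin_one]
  rw [neg_pow, MvPolynomial.smul_eq_C_mul, map_pow, map_neg, map_one]
  ring

theorem isHomogeneous_X_pow_mul_X_pow {d k : ℕ} (hk : k ≤ d) :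
    (MvPolynomial.X 0 ^ (d - k) * MvPolynomial.X 1 ^ k :
      MvPolynomial (Fin 2) R).IsHomogeneous d := by
  have h := (MvPolynomial.isHomogeneous_X_pow (R := R) (0 : Fin 2) (d - k)).mul
    (MvPolynomial.isHomogeneous_X_pow (R := R) (1 : Fin 2) k)
  rwa [Nat.sub_add_cancel hk] at h

/-- The class of `X ^ (d - k) Y ^ k` in the coinvariants, for `k ≤ d`. -/
def coinvariantsMonomial (R : Type) [CommRing R] (d : ℕ) (k : Fin (d + 1)) :
    coinvariantsDegree R d :=
  ⟨Representation.Coinvariants.mk (polyAction R)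
    (MvPolynomial.X 0 ^ (d - k.1) * MvPolynomial.X 1 ^ k.1),
    Submodule.mem_map_of_mem ((MvPolynomial.mem_homogeneousSubmodule _ _).2
      (isHomogeneous_X_pow_mul_X_pow (Nat.lt_succ_iff.1 k.2)))⟩

theorem monomial_fin_two_eq (s : Fin 2 →₀ ℕ) (c : R) : MvPolynomial.monomial s c =
    c • (MvPolynomial.X 0 ^ s 0 * MvPolynomial.X 1 ^ s 1) := by
  rw [MvPolynomial.monomial_eq, Finsupp.prod_fintype _ _ (fun _ => pow_zero _),
    Fin.prod_univ_two, MvPolynomial.smul_eq_C_mul]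

theorem span_coinvariantsMonomial (R : Type) [CommRing R] (d : ℕ) :
    Submodule.span R (Set.range (coinvariantsMonomial R d)) = ⊤ := by
  rw [eq_top_iff]
  rintro ⟨x, hx⟩ -
  obtain ⟨P, hP, rfl⟩ := id hx
  have hP' : P.IsHomogeneous d := hP
  suffices h : Representation.Coinvariants.mk (polyAction R) P ∈
      (Submodule.span R (Set.range (coinvariantsMonomial R d))).map
        (coinvariantsDegree R d).subtype by
    obtain ⟨y, hy, hyx⟩ := h
    have hxy : (⟨_, hx⟩ : coinvariantsDegree R d) = y := Subtype.ext hyx.symm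
    rw [hxy]
    exact hy
  rw [← MvPolynomial.support_sum_monomial_coeff P, map_sum]
  refine Submodule.sum_mem _ fun s hs => ?_
  have hdeg : s 0 + s 1 = d := by
    have := hP' (MvPolynomial.mem_support_iff.1 hs)
    rwa [Finsupp.weight_apply, Finsupp.sum_fintype _ _ (by simp), Fin.sum_univ_two,
      Pi.one_apply, Pi.one_apply, smul_eq_mul, smul_eq_mul, mul_one, mul_one] at this
  rw [monomial_fin_two_eq, map_smul]
  refine Submodule.smul_mem _ _ ⟨coinvariantsMonomial R d ⟨s 1, by omega⟩,
    Submodule.subset_span ⟨_, rfl⟩, ?_⟩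
  have h0 : s 0 = d - s 1 := by omega
  rw [h0]
  rfl

instance (R : Type) [CommRing R] (d : ℕ) : Module.Finite R (coinvariantsDegree R d) :=
  ⟨by
    rw [← span_coinvariantsMonomial R d]
    exact Submodule.fg_span (Set.finite_range _)⟩

end Coinvariants

section Functionals

variable {p δ d : ℕ}

theorem exists_mem_invariantFunctionals_of_coinvariants (hp : p.Prime)
    (μ : coinvariantsDegree (ZMod (p ^ δ)) d →ₗ[ZMod (p ^ δ)] ZMod (p ^ δ)) :
    ∃ φ ∈ invariantFunctionals ((p ^ δ : ℕ) : ℤ) d, ∀ k : Fin (d + 1),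
      μ (coinvariantsMonomial _ d k) = (φ (X ^ k.1) : ZMod (p ^ δ)) := by
  have : NeZero (p ^ δ) := ⟨pow_ne_zero _ hp.ne_zero⟩
  choose c hc using fun k => ZMod.intCast_surjective (μ (coinvariantsMonomial _ d k))
  set φ := functionalOfSeq fun k => if h : k < d + 1 then c ⟨k, h⟩ else 0 with hφ
  have hval : ∀ k : Fin (d + 1), (φ (X ^ k.1) : ZMod (p ^ δ)) = μ (coinvariantsMonomial _ d k) := by
    intro k
    rw [hφ, functionalOfSeq_X_pow, dif_pos k.2, hc]
  refine ⟨φ, ?_, fun k => (hval k).symm⟩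
  rw [mem_invariantFunctionals_iff]
  refine ⟨fun k hk => ?_, fun k hk => ?_⟩
  · rw [← ZMod.intCast_eq_intCast_iff_dvd_sub]
    have hmk : coinvariantsMonomial (ZMod (p ^ δ)) d ⟨k, by omega⟩ =
        ∑ m ∈ (Finset.range (k + 1)).attach, (k.choose m.1 : ZMod (p ^ δ)) •
          coinvariantsMonomial (ZMod (p ^ δ)) d
            ⟨m.1, by have := Finset.mem_range.1 m.2; omega⟩ := by
      apply Subtype.ext
      rw [AddSubmonoidClass.coe_finsetSum]
      simp only [Submodule.coe_smul, coinvariantsMonomial]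
      rw [Finset.sum_attach (Finset.range (k + 1)) fun m => (k.choose m : ZMod (p ^ δ)) •
        Representation.Coinvariants.mk (polyAction (ZMod (p ^ δ)))
          (MvPolynomial.X 0 ^ (d - m) * MvPolynomial.X 1 ^ m)]
      rw [← Representation.Coinvariants.mk_self_apply _ (upperTransvection 1),
        polyAction_upperTransvection, Nat.sub_add_cancel hk, map_sum]
      simp only [map_smul]
    have h1 := hval ⟨k, by omega⟩
    rw [hmk, map_sum] at h1
    simp only [map_smul, ← hval] at h1
    rw [Finset.sum_attach (Finset.range (k + 1)) fun m => (k.choose m : ZMod (p ^ δ)) •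
      (φ (X ^ m) : ZMod (p ^ δ))] at h1
    rw [apply_X_add_one_pow, h1]
    push_cast
    rfl
  · rw [← ZMod.intCast_eq_intCast_iff_dvd_sub]
    have hmk : coinvariantsMonomial (ZMod (p ^ δ)) d ⟨k, by omega⟩ =
        (-1 : ZMod (p ^ δ)) ^ k • coinvariantsMonomial (ZMod (p ^ δ)) d ⟨d - k, by omega⟩ := by
      apply Subtype.ext
      simp only [Submodule.coe_smul, coinvariantsMonomial]
      rw [← Representation.Coinvariants.mk_self_apply _ (weylElement _),
        polyAction_weylElement, map_smul, Nat.sub_sub_self hk]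
    have h1 := hval ⟨k, by omega⟩
    rw [hmk, map_smul, ← hval] at h1
    rw [h1]
    push_cast
    rfl

/-- Extended by zero outside degree `d`, the functional is fixed by the two generators, hence by the
whole group, and factors through the coinvariants. -/
theorem exists_coinvariants_functional (hp : p.Prime) (hδ : 1 ≤ δ) {φ : ℤ[X] →ₗ[ℤ] ℤ}
    (hφ : φ ∈ invariantFunctionals ((p ^ δ : ℕ) : ℤ) d) :
    ∃ μ : coinvariantsDegree (ZMod (p ^ δ)) d →ₗ[ZMod (p ^ δ)] ZMod (p ^ δ), ∀ k : Fin (d + 1),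
      μ (coinvariantsMonomial _ d k) = (φ (X ^ k.1) : ZMod (p ^ δ)) := by
  set R := ZMod (p ^ δ)
  set Λ : MvPolynomial (Fin 2) R →ₗ[R] R := (MvPolynomial.basisMonomials (Fin 2) R).constr R
    fun s => if s 0 + s 1 = d then (φ (X ^ s 1) : R) else 0 with hΛ
  have hval : ∀ a b, Λ (MvPolynomial.X 0 ^ a * MvPolynomial.X 1 ^ b) =
      if a + b = d then (φ (X ^ b) : R) else 0 := by
    intro a b
    have h := (MvPolynomial.basisMonomials (Fin 2) R).constr_basis R
      (fun s => if s 0 + s 1 = d then (φ (X ^ s 1) : R) else 0)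
      (Finsupp.single 0 a + Finsupp.single 1 b)
    rw [MvPolynomial.coe_basisMonomials] at h
    simp only [monomial_fin_two_eq] at h
    simpa using h
  have hext : ∀ g, (∀ a b, Λ (polyAction R g (MvPolynomial.X 0 ^ a * MvPolynomial.X 1 ^ b)) =
      Λ (MvPolynomial.X 0 ^ a * MvPolynomial.X 1 ^ b)) → Λ ∘ₗ polyAction R g = Λ := by
    intro g h
    refine (MvPolynomial.basisMonomials (Fin 2) R).ext fun s => ?_
    rw [MvPolynomial.coe_basisMonomials, LinearMap.comp_apply]
    simp only [monomial_fin_two_eq, one_smul]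
    exact h _ _
  let H : Subgroup (Matrix.SpecialLinearGroup (Fin 2) R) :=
    { carrier := {g | Λ ∘ₗ polyAction R g = Λ}
      one_mem' := by
        change Λ ∘ₗ polyAction R 1 = Λ
        rw [map_one]
        rfl
      mul_mem' := by
        intro g h (hg : Λ ∘ₗ polyAction R g = Λ) (hh : Λ ∘ₗ polyAction R h = Λ)
        change Λ ∘ₗ polyAction R (g * h) = Λ
        rw [map_mul, Module.End.mul_eq_comp, ← LinearMap.comp_assoc, hg, hh]
      inv_mem' := by
        intro g (hg : Λ ∘ₗ polyAction R g = Λ)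
        change Λ ∘ₗ polyAction R g⁻¹ = Λ
        conv_lhs => rw [← hg]
        rw [LinearMap.comp_assoc, ← Module.End.mul_eq_comp, ← map_mul, mul_inv_cancel, map_one]
        rfl }
  have hφ' := mem_invariantFunctionals_iff.1 hφ
  have hU : upperTransvection 1 ∈ H := by
    refine hext _ fun a b => ?_
    rw [polyAction_upperTransvection, map_sum, hval]
    have h1 : ∀ m ∈ Finset.range (b + 1), Λ ((b.choose m : R) •
        (MvPolynomial.X 0 ^ (a + b - m) * MvPolynomial.X 1 ^ m)) =
        if a + b = d then ((((b.choose m : ℤ) * φ (X ^ m) : ℤ)) : R) else 0 := by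
      intro m hm
      rw [Finset.mem_range] at hm
      rw [map_smul, hval, Nat.sub_add_cancel (by omega)]
      split_ifs
      · rw [Int.cast_mul, Int.cast_natCast, smul_eq_mul]
      · exact smul_zero _
    rw [Finset.sum_congr rfl h1]
    split_ifs with h
    · rw [← Int.cast_sum, ← apply_X_add_one_pow, ZMod.intCast_eq_intCast_iff_dvd_sub,
        dvd_sub_comm]
      exact hφ'.1 b (by omega)
    · simp
  have hW : weylElement R ∈ H := by
    refine hext _ fun a b => ?_
    rw [polyAction_weylElement, map_smul, hval, hval, add_comm b a]
    split_ifs with h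
    · have h2 := hφ'.2 b (by omega)
      rw [show d - b = a by omega, ← ZMod.intCast_eq_intCast_iff_dvd_sub] at h2
      rw [← h2]
      push_cast
      rfl
    · exact smul_zero _
  have hH := subgroup_eq_top_of_mem hp hδ H hU hW
  have hinv : ∀ g, Λ ∘ₗ polyAction R g = Λ := fun g => by
    have : g ∈ H := hH ▸ Subgroup.mem_top g
    exact this
  refine ⟨Representation.Coinvariants.lift _ Λ hinv ∘ₗ (coinvariantsDegree R d).subtype,
    fun k => ?_⟩
  rw [LinearMap.comp_apply, Submodule.subtype_apply, coinvariantsMonomial,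
    Representation.Coinvariants.lift_mk, hval, if_pos (by omega)]

/-- The rank criterion rewritten for integer-valued functionals: it suffices to find invariant
functionals whose reductions modulo `p` form a basis of the reductions of all invariant ones. -/
theorem finrank_coinvariantsDegree (hp : p.Prime) (hδ : 1 ≤ δ) {ι : Type} [Fintype ι]
    (χ : ι → ℤ[X] →ₗ[ℤ] ℤ) (hχ : ∀ i, χ i ∈ invariantFunctionals ((p ^ δ : ℕ) : ℤ) d)
    (hind : ∀ x : ι → ℤ, (∀ k ≤ d, (p : ℤ) ∣ ∑ i, x i * χ i (X ^ k)) → ∀ i, (p : ℤ) ∣ x i)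
    (hspan : ∀ φ ∈ invariantFunctionals ((p ^ δ : ℕ) : ℤ) d, ∃ x : ι → ℤ, ∀ k ≤ d,
      (p : ℤ) ∣ φ (X ^ k) - ∑ i, x i * χ i (X ^ k)) :
    Module.finrank (ZMod (p ^ δ)) (coinvariantsDegree (ZMod (p ^ δ)) d) = Fintype.card ι := by
  choose l hl using fun i => exists_coinvariants_functional hp hδ (hχ i)
  set π := ZMod.castHom (dvd_pow_self p (by omega : δ ≠ 0)) (ZMod p) with hπ
  refine finrank_eq_card_of_functionals hp hδ l (fun x hx => ?_) (fun μ => ?_)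
  · choose y hy using fun i => ZMod.intCast_surjective (x i)
    ext i
    rw [← hy, Pi.zero_apply, ZMod.intCast_zmod_eq_zero_iff_dvd]
    refine hind y (fun k hk => ?_) i
    rw [← ZMod.intCast_zmod_eq_zero_iff_dvd]
    have h := hx (coinvariantsMonomial _ d ⟨k, by omega⟩)
    simp only [hl, map_intCast, ← hy] at h
    push_cast
    exact h
  · obtain ⟨φ, hφ, hμ⟩ := exists_mem_invariantFunctionals_of_coinvariants hp μ
    obtain ⟨x, hx⟩ := hspan φ hφ
    refine ⟨fun i => (x i : ZMod p), fun v => ?_⟩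
    have hv : v ∈ Submodule.span (ZMod (p ^ δ))
        (Set.range (coinvariantsMonomial (ZMod (p ^ δ)) d)) := by
      rw [span_coinvariantsMonomial]
      exact Submodule.mem_top
    induction hv using Submodule.span_induction with
    | mem v hv =>
      obtain ⟨k, rfl⟩ := hv
      have h := hx k.1 (Nat.lt_succ_iff.1 k.2)
      rw [← ZMod.intCast_zmod_eq_zero_iff_dvd, Int.cast_sub, sub_eq_zero] at h
      simp only [hl, hμ, map_intCast]
      rw [h]
      push_cast
      rfl
    | zero => simp
    | add v w _ _ h1 h2 => simp only [map_add, h1, h2, mul_add, Finset.sum_add_distrib]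
    | smul c v _ h1 =>
      simp only [map_smul, smul_eq_mul, map_mul, h1, Finset.mul_sum]
      exact Finset.sum_congr rfl fun i _ => by ring

end Functionals

/-! ### Counting the exponents and the generating function -/

/-- The exponents `(i, j)` of the classes `1 / (L ^ (p ^ k i) Q ^ (p ^ k j))` of degree `d`. -/
def residueExponents (p k d : ℕ) : Finset (ℕ × ℕ) :=
  (Finset.range (d + 3) ×ˢ Finset.range (d + 3)).filter fun t => 1 ≤ t.1 ∧ 1 ≤ t.2 ∧
    d + 2 = p ^ k * (t.1 * (p + 1) + t.2 * (p * (p - 1)))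

theorem mem_residueExponents {p k d : ℕ} (hp : p.Prime) {t : ℕ × ℕ} :
    t ∈ residueExponents p k d ↔ 1 ≤ t.1 ∧ 1 ≤ t.2 ∧
      d + 2 = p ^ k * (t.1 * (p + 1) + t.2 * (p * (p - 1))) := by
  rw [residueExponents, Finset.mem_filter, and_iff_right_iff_imp]
  rintro ⟨-, -, h⟩
  have hq : 1 ≤ p ^ k := Nat.one_le_pow _ _ hp.pos
  have hb : 1 ≤ p * (p - 1) := by
    have := hp.two_le
    exact Nat.mul_le_mul hp.one_le (by omega : 1 ≤ p - 1)
  have h1 : t.1 * (p + 1) + t.2 * (p * (p - 1)) ≤ d + 2 := h ▸ Nat.le_mul_of_pos_left _ hq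
  have h2 : t.1 ≤ t.1 * (p + 1) := Nat.le_mul_of_pos_right _ (by omega)
  have h3 : t.2 ≤ t.2 * (p * (p - 1)) := Nat.le_mul_of_pos_right _ hb
  rw [Finset.mem_product, Finset.mem_range, Finset.mem_range]
  omega

theorem residueSpan_eq {p : ℕ} (hp : p.Prime) (k d : ℕ) :
    residueSpan p k d = Submodule.span ℤ (Set.range fun t : residueExponents p k d =>
      dicksonResidue p (k + 1) (p ^ k * t.1.1) (p ^ k * t.1.2)) := by
  rw [residueSpan]
  congr 1
  ext φ
  constructor
  · rintro ⟨i, j, hi, hj, hd, rfl⟩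
    exact ⟨⟨(i, j), (mem_residueExponents hp).2 ⟨hi, hj, hd⟩⟩, rfl⟩
  · rintro ⟨⟨t, ht⟩, rfl⟩
    obtain ⟨hi, hj, hd⟩ := (mem_residueExponents hp).1 ht
    exact ⟨t.1, t.2, hi, hj, hd, rfl⟩

theorem finrank_coinvariantsDegree_of_pos {p k d : ℕ} (hp : p.Prime) (hp3 : 3 < p) (hk : 1 ≤ k)
    (hd : 1 ≤ d) :
    Module.finrank (ZMod (p ^ (k + 1))) (coinvariantsDegree (ZMod (p ^ (k + 1))) d) =
      (residueExponents p k d).card := by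
  classical
  have hp2 : Odd p := hp.odd_of_ne_two (by omega)
  rw [← Fintype.card_coe]
  refine finrank_coinvariantsDegree hp (by omega) (fun t : residueExponents p k d =>
    dicksonResidue p (k + 1) (p ^ k * t.1.1) (p ^ k * t.1.2)) (fun t => ?_) (fun x hx t => ?_)
    (fun φ hφ => ?_)
  · obtain ⟨hi, hj, ht⟩ := (mem_residueExponents hp).1 t.2
    exact dicksonResidue_mem hp hp2 k hi hj ht
  · have h := dvd_coeff_of_dvd_sum_dicksonResidue hp k d (residueExponents p k d)
      (fun t ht => (mem_residueExponents hp).1 ht)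
      (fun t => if h : t ∈ residueExponents p k d then x ⟨t, h⟩ else 0) (fun l hl => ?_) t.1 t.2
    · rwa [dif_pos t.2] at h
    · rw [← Finset.sum_coe_sort]
      refine (hx l hl).trans (dvd_of_eq (Finset.sum_congr rfl fun t _ => ?_))
      rw [dif_pos t.2]
  · obtain ⟨ψ, hψ, h⟩ := exists_residueSpan_dvd_sub hp hp3 hk hd hφ
    rw [residueSpan_eq hp, Submodule.mem_span_range_iff_exists_fun] at hψ
    obtain ⟨x, rfl⟩ := hψ
    exact ⟨x, fun l hl => by simpa using h l hl⟩

/-- On constants the action is trivial, so every functional is invariant. This degree escapes the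
classification, where `d ≥ 1` forces `φ(1) ≡ 0`. -/
theorem finrank_coinvariantsDegree_zero {p δ : ℕ} (hp : p.Prime) (hδ : 1 ≤ δ) :
    Module.finrank (ZMod (p ^ δ)) (coinvariantsDegree (ZMod (p ^ δ)) 0) = 1 := by
  have h := finrank_coinvariantsDegree (d := 0) hp hδ (ι := Unit)
    (fun _ => functionalOfSeq fun _ => 1) (fun _ => ?_) (fun x hx i => ?_) (fun φ _ => ?_)
  · simpa using h
  · rw [mem_invariantFunctionals_iff]
    refine ⟨fun k hk => ?_, fun k hk => ?_⟩
    · rw [Nat.le_zero.1 hk]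
      simp
    · rw [Nat.le_zero.1 hk]
      simp
  · have h := hx 0 le_rfl
    simp only [functionalOfSeq_X_pow] at h
    simpa using h
  · refine ⟨fun _ => φ (X ^ 0), fun k hk => ?_⟩
    rw [Nat.le_zero.1 hk]
    simp only [functionalOfSeq_X_pow]
    simp

theorem mk_dvd_mul_one_sub_X_pow {A : ℕ} (hA : 1 ≤ A) :
    (PowerSeries.mk fun n => if A ∣ n then (1 : ℚ) else 0) * (1 - PowerSeries.X ^ A) = 1 := by
  ext n
  rw [mul_sub, mul_one, map_sub, PowerSeries.coeff_mul_X_pow', PowerSeries.coeff_mk,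
    PowerSeries.coeff_one]
  by_cases hn : A ≤ n
  · rw [if_pos hn, PowerSeries.coeff_mk, if_neg (by omega : n ≠ 0)]
    rw [if_congr (Nat.dvd_sub_iff_left hn dvd_rfl) rfl rfl, sub_self]
  · rw [if_neg hn, sub_zero]
    refine if_congr ?_ rfl rfl
    constructor
    · intro h
      by_contra h0
      exact hn (Nat.le_of_dvd (by omega) h)
    · rintro rfl
      exact dvd_zero _

theorem inv_one_sub_X_pow_mul {A B : ℕ} (hA : 1 ≤ A) (hB : 1 ≤ B) :
    ((1 - PowerSeries.X ^ A) * (1 - PowerSeries.X ^ B) : PowerSeries ℚ)⁻¹ =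
      PowerSeries.mk fun n =>
        (((Finset.HasAntidiagonal.antidiagonal n).filter fun t => A ∣ t.1 ∧ B ∣ t.2).card : ℚ) := by
  have h0 : PowerSeries.constantCoeff
      ((1 - PowerSeries.X ^ A) * (1 - PowerSeries.X ^ B) : PowerSeries ℚ) ≠ 0 := by
    rw [map_mul, map_sub, map_sub, map_pow, map_pow, PowerSeries.constantCoeff_X,
      zero_pow (by omega), zero_pow (by omega)]
    simp
  have h1 : (PowerSeries.mk fun n =>
      (((Finset.HasAntidiagonal.antidiagonal n).filter fun t => A ∣ t.1 ∧ B ∣ t.2).card : ℚ)) =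
      (PowerSeries.mk fun n => if A ∣ n then (1 : ℚ) else 0) *
        (PowerSeries.mk fun n => if B ∣ n then (1 : ℚ) else 0) := by
    ext n
    rw [PowerSeries.coeff_mk, PowerSeries.coeff_mul, Finset.card_filter, Nat.cast_sum]
    refine Finset.sum_congr rfl fun t _ => ?_
    rw [PowerSeries.coeff_mk, PowerSeries.coeff_mk]
    by_cases h : A ∣ t.1 <;> by_cases h' : B ∣ t.2 <;> simp [h, h']
  symm
  rw [PowerSeries.eq_inv_iff_mul_eq_one h0, h1]
  calc _ = ((PowerSeries.mk fun n => if A ∣ n then (1 : ℚ) else 0) * (1 - PowerSeries.X ^ A)) *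
        ((PowerSeries.mk fun n => if B ∣ n then (1 : ℚ) else 0) * (1 - PowerSeries.X ^ B)) := by
        ring
    _ = 1 := by rw [mk_dvd_mul_one_sub_X_pow hA, mk_dvd_mul_one_sub_X_pow hB, one_mul]

/-- Replacing `(i, j)` by `(i - 1, j - 1)` turns positive exponents into nonnegative ones; the
shift, together with the `2` in `d + 2`, is the exponent of the numerator. -/
theorem card_residueExponents {p k d : ℕ} (hp : p.Prime) : (residueExponents p k d).card =
    if p ^ k * (p + 1) + p ^ k * (p * (p - 1)) ≤ d + 2 then
      ((Finset.HasAntidiagonal.antidiagonal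
        (d + 2 - (p ^ k * (p + 1) + p ^ k * (p * (p - 1))))).filter fun t =>
        p ^ k * (p + 1) ∣ t.1 ∧ p ^ k * (p * (p - 1)) ∣ t.2).card else 0 := by
  have hq : 1 ≤ p ^ k := Nat.one_le_pow _ _ hp.pos
  have hb : 1 ≤ p * (p - 1) := by
    have := hp.two_le
    exact Nat.mul_le_mul hp.one_le (by omega : 1 ≤ p - 1)
  have hA : 0 < p ^ k * (p + 1) := Nat.mul_pos (by omega) (by omega)
  have hB : 0 < p ^ k * (p * (p - 1)) := Nat.mul_pos (by omega) (by omega)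
  have hmem : ∀ t : ℕ × ℕ, t ∈ residueExponents p k d ↔ 1 ≤ t.1 ∧ 1 ≤ t.2 ∧
      d + 2 = p ^ k * (p + 1) * t.1 + p ^ k * (p * (p - 1)) * t.2 := by
    intro t
    rw [mem_residueExponents hp, show p ^ k * (t.1 * (p + 1) + t.2 * (p * (p - 1))) =
      p ^ k * (p + 1) * t.1 + p ^ k * (p * (p - 1)) * t.2 by ring]
  generalize p ^ k * (p + 1) = A at *
  generalize p ^ k * (p * (p - 1)) = B at *
  have hpred : ∀ (C i : ℕ), 1 ≤ i → C * i = C * (i - 1) + C := fun C i hi => by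
    rw [← Nat.mul_succ, Nat.succ_eq_add_one, Nat.sub_add_cancel hi]
  split_ifs with h
  · refine Finset.card_nbij' (fun t => (A * (t.1 - 1), B * (t.2 - 1)))
      (fun t => (t.1 / A + 1, t.2 / B + 1)) ?_ ?_ ?_ ?_
    · intro t ht
      obtain ⟨h1, h2, h3⟩ := (hmem t).1 ht
      rw [Finset.mem_coe, Finset.mem_filter, Finset.HasAntidiagonal.mem_antidiagonal]
      have h4 := hpred A t.1 h1
      have h5 := hpred B t.2 h2
      refine ⟨?_, dvd_mul_right _ _, dvd_mul_right _ _⟩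
      simp only
      omega
    · intro t ht
      rw [Finset.mem_coe, Finset.mem_filter, Finset.HasAntidiagonal.mem_antidiagonal] at ht
      obtain ⟨h1, h2, h3⟩ := ht
      refine (hmem _).2 ⟨by simp, by simp, ?_⟩
      simp only [mul_add, mul_one, Nat.mul_div_cancel' h2, Nat.mul_div_cancel' h3]
      omega
    · intro t ht
      obtain ⟨h1, h2, h3⟩ := (hmem t).1 ht
      ext
      · simp only [Nat.mul_div_cancel_left _ hA]
        omega
      · simp only [Nat.mul_div_cancel_left _ hB]
        omega
    · intro t ht
      rw [Finset.mem_coe, Finset.mem_filter, Finset.HasAntidiagonal.mem_antidiagonal] at ht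
      obtain ⟨h1, h2, h3⟩ := ht
      ext
      · simp only [Nat.add_sub_cancel, Nat.mul_div_cancel' h2]
      · simp only [Nat.add_sub_cancel, Nat.mul_div_cancel' h3]
  · rw [Finset.card_eq_zero, Finset.eq_empty_iff_forall_notMem]
    intro t ht
    obtain ⟨h1, h2, h3⟩ := (hmem t).1 ht
    have h4 := hpred A t.1 h1
    have h5 := hpred B t.2 h2
    omega

end

theorem mainTheorem5 (p δ : ℕ) (hp : p.Prime) (hp3 : 3 < p) (hδ : 2 ≤ δ) :
    coinvariantsHilb p δ =
      1 + (PowerSeries.X : PowerSeries ℚ) ^ (p ^ (δ + 1) + p ^ (δ - 1) - 2) *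
        ((1 - PowerSeries.X ^ (p ^ (δ - 1) * (p + 1))) *
          (1 - PowerSeries.X ^ (p ^ δ * (p - 1))))⁻¹ := by
  obtain ⟨k, rfl⟩ : ∃ k, δ = k + 1 := ⟨δ - 1, by omega⟩
  have hk : 1 ≤ k := by omega
  have hq : 1 ≤ p ^ k := Nat.one_le_pow _ _ hp.pos
  have hB : p ^ (k + 1) * (p - 1) = p ^ k * (p * (p - 1)) := by ring
  have hA1 : 1 ≤ p ^ k * (p + 1) := Nat.mul_le_mul hq (by omega : 1 ≤ p + 1)
  have hB1 : 1 ≤ p ^ k * (p * (p - 1)) :=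
    Nat.mul_le_mul hq (Nat.mul_le_mul hp.one_le (by omega : 1 ≤ p - 1))
  have hE : p ^ (k + 1 + 1) + p ^ k = p ^ k * (p + 1) + p ^ k * (p * (p - 1)) := by
    obtain ⟨r, rfl⟩ : ∃ r, p = r + 1 := ⟨p - 1, by omega⟩
    rw [Nat.add_sub_cancel]
    ring
  have hE3 : 3 ≤ p ^ k * (p + 1) + p ^ k * (p * (p - 1)) := by
    have : 1 * 4 ≤ p ^ k * (p + 1) := Nat.mul_le_mul hq (by omega)
    omega
  rw [Nat.add_sub_cancel, hB, hE, inv_one_sub_X_pow_mul hA1 hB1]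
  ext d
  rw [coinvariantsHilb, PowerSeries.coeff_mk, map_add, PowerSeries.coeff_X_pow_mul',
    PowerSeries.coeff_one]
  rcases Nat.eq_zero_or_pos d with rfl | hd
  · rw [finrank_coinvariantsDegree_zero hp (by omega), if_pos rfl, if_neg (by omega)]
    simp
  · rw [finrank_coinvariantsDegree_of_pos hp hp3 hk hd, card_residueExponents hp,
      if_neg (by omega : d ≠ 0), zero_add]
    split_ifs with h1 h2 h2
    · rw [PowerSeries.coeff_mk, Nat.sub_sub_right d (by omega)]
    · omega
    · omega
    · simp
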